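/- Let $D<0$ be a discriminant, let $\mathcal O=\mathbb Z\big[\tfrac{D+\sqrt D}{2}\big]\subset\mathbb C$ be the imaginary quadratic order of discriminant $D$ (with $\sqrt D=i\sqrt{|D|}$), let $w=|\mathcal O^\times|$, and let $I(\mathcal O)$ be its group of invertible fractional ideals. Write $[a,b,c]$ for the form $ax^2+bxy+cy^2$ with integer coefficients. Let $Cl(D)$ be the group of $SL_2(\mathbb Z)$-classes of primitive positive definite forms of discriminant $D$, identified with the ideal class group $Cl(\mathcal O)$ by sending $[a,b,c]$ to the class of the ideal $\mathcal I([a,b,c])=\mathbb Za+\mathbb Z\frac{b-\sqrt D}{2}$. Assume $Cl(D)\cong(\mathbb Z/2)^g$ for some $g\ge 0$. Let $Q=[a,ka,c]$ have discriminant $D$, with $a>0$ and $k,c\in\mathbb Z$. For a positive divisor $d$ of $a$ put $Q_{/d}=[\tfrac ad,ka,cd]$, and let $\delta$ be a set of positive divisors of $a$ such that $\{Q_{/d}\}_{d\in\delta}$ is a set of representatives of $Cl(D)$: each $Q_{/d}$, $d\in\delta$, is primitive of discriminant $D$, and every primitive positive definite form of discriminant $D$ is $SL_2(\mathbb Z)$-equivalent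 to $Q_{/d}$ for exactly one $d\in\delta$. Put $\tau=\tau_Q=\frac{-ka+\sqrt D}{2a}$ and $$H_d(\tau)=\sum_{(m,n)\in\mathbb Z^2\setminus\{(0,0)\}}\Big(2\,\mathrm{Re}\,\frac{1}{(dm\tau+n)^{3}(dm\bar\tau+n)}+\frac{1}{(dm\tau+n)^{2}(dm\bar\tau+n)^{2}}\Big).$$ For a form $F=[A,B,C]$ put $\theta_F=\sum_{m,n\in\mathbb Z}q^{F(m,n)}$ and $\Theta_F=\sum_{m,n\in\mathbb Z}\frac12(Am^2-Cn^2)q^{F(m,n)}$; for $f=\sum_n a_nq^n$ put $L(f,s)=\sum_{n\ge1}a_nn^{-s}$. For a homomorphism $\Phi:I(\mathcal O)\to\mathbb C^\times$ put $f_\Phi=\sum_{\mathfrak b}\Phi(\mathfrak b)q^{|\mathcal O/\mathfrak b|}$, summed over the invertible integral ideals $\mathfrak b\subseteq\mathcal O$. For a character $\varphi:Cl(D)\to\{\pm1\}$ put $$f_{\varphi,1}=w\sum_{\mathfrak b}\varphi([\mathfrak b])\,q^{|\mathcal O/\mathfrak b|},\qquad f_{\varphi,3}=\sum_{d\in\delta}\varphi(Q_{/d})\,\Theta_{Q_{/d}},$$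 the first sum again being over the invertible integral ideals. Then for every character $\varphi:Cl(D)\to\{\pm1\}$ the series $H_d(\tau)$ $(d\in\delta)$, $L(f_{\varphi,3},3)$ and $L(f_{\varphi,1},2)$ converge absolutely, and $$\sum_{d\in\delta}\varphi(Q_{/d})\frac{\mathrm{Im}\,\tau}{(2\pi)^3}\,d^2H_d(\tau)=\frac{a\sqrt{|D|}}{(2\pi)^3}\Big(2L(f_{\varphi,3},3)+\tfrac12L(f_{\varphi,1},2)\Big).$$ Moreover, $f_{\varphi,1}$ and $\sum_{d\in\delta}\varphi(Q_{/d})\theta_{Q_{/d}}$ have the same $n$-th coefficient for every $n\ge1$. And if $\Phi:I(\mathcal O)\to\mathbb C^\times$ is a Hecke character of $\infty$-type $2$ (a homomorphism with $\Phi(\alpha\mathcal O)=\alpha^2$ for all nonzero $\alpha\in\mathcal O$) given by $\varphi$ in the sense that $\Phi(\mathcal I(Q_{/d}))=\varphi(Q_{/d})\frac ad$ for all $d\in\delta$, then $f_{\varphi,3}=f_\Phi$ in all coefficients with $n\ge 1$, so that the identity holds with $L(f_\Phi,3)$ in place of $L(f_{\varphi,3},3)$. -/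

import Mathlib

open scoped nonZeroDivisors

/-! ### Binary quadratic forms -/

/-- The binary quadratic form `[a, b, c] = a x ^ 2 + b x y + c y ^ 2` with integer coefficients. -/
structure BinForm where
  a : ℤ
  b : ℤ
  c : ℤ

namespace BinForm

/-- The value `Q(x, y)`. -/
def eval (Q : BinForm) (x y : ℤ) : ℤ := Q.a * x ^ 2 + Q.b * x * y + Q.c * y ^ 2

/-- The discriminant `b ^ 2 - 4 a c`. -/
def disc (Q : BinForm) : ℤ := Q.b ^ 2 - 4 * Q.a * Q.c

/-- `Q` is a primitive form of discriminant `D` with positive leading coefficient; for `D < 0` these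
are exactly the primitive positive definite forms of discriminant `D`. -/
structure IsPrimPosDef (D : ℤ) (Q : BinForm) : Prop where
  disc_eq : Q.disc = D
  primitive : Int.gcd (Int.gcd Q.a Q.b) Q.c = 1
  pos : 0 < Q.a

/-- Proper equivalence: `F(x, y) = G(p x + q y, r x + s y)` for some `(p, q; r, s)` in `SL₂(ℤ)`. -/
def Equivalent (F G : BinForm) : Prop :=
  ∃ g : Matrix.SpecialLinearGroup (Fin 2) ℤ, ∀ x y : ℤ,
    F.eval x y = G.eval (g 0 0 * x + g 0 1 * y) (g 1 0 * x + g 1 1 * y)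

/-- The form `Q_{/d} = [a / d, b, c d]`, used for `d ∣ a`. -/
def divBy (Q : BinForm) (d : ℕ) : BinForm := ⟨Q.a / d, Q.b, Q.c * d⟩

end BinForm

noncomputable section

/-- The square root `√D = i √|D|` of a negative integer `D`. -/
def sqrtNeg (D : ℤ) : ℂ := Complex.I * (Real.sqrt (-(D : ℝ)) : ℂ)

/-- The root `τ_Q = (-b + √D) / (2 a)` of `Q(x, 1)` in the upper half plane, for a positive
definite form `Q` of discriminant `D`. -/
def BinForm.tau (Q : BinForm) : ℂ := (-(Q.b : ℂ) + sqrtNeg Q.disc) / (2 * (Q.a : ℂ))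

/-! ### The Eisenstein-Kronecker series -/

/-- The `(m, n)` term of `H_d(τ)`, namely
`2 Re ((d m τ + n)⁻³ (d m τ̄ + n)⁻¹) + (d m τ + n)⁻² (d m τ̄ + n)⁻²`. -/
def kroneckerTerm (d : ℕ) (τ : ℂ) (m n : ℤ) : ℂ :=
  let z : ℂ := d * m * τ + n
  let z' : ℂ := d * m * (starRingEnd ℂ) τ + n
  ((2 * ((z ^ 3)⁻¹ * z'⁻¹).re : ℝ) : ℂ) + (z ^ 2)⁻¹ * (z' ^ 2)⁻¹

/-- `H_d(τ)`, the sum of the above terms over `(m, n) ∈ ℤ² \ {(0, 0)}`. -/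
def kroneckerH (d : ℕ) (τ : ℂ) : ℂ :=
  ∑' p : {p : ℤ × ℤ // p ≠ 0}, kroneckerTerm d τ p.1.1 p.1.2

/-! ### Theta series, given by their `q`-expansion coefficients -/

/-- The coefficient of `q ^ N` in `θ_Q = ∑_{m, n} q ^ Q(m, n)`. -/
def thetaOne (Q : BinForm) (N : ℕ) : ℂ :=
  ∑ᶠ p ∈ {p : ℤ × ℤ | Q.eval p.1 p.2 = N}, (1 : ℂ)

/-- The coefficient of `q ^ N` in `Θ_Q = ∑_{m, n} (1 / 2) (a m ^ 2 - c n ^ 2) q ^ Q(m, n)`. -/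
def thetaThree (Q : BinForm) (N : ℕ) : ℂ :=
  ∑ᶠ p ∈ {p : ℤ × ℤ | Q.eval p.1 p.2 = N},
    (1 / 2 : ℂ) * ((Q.a : ℂ) * (p.1 : ℂ) ^ 2 - (Q.c : ℂ) * (p.2 : ℂ) ^ 2)

/-! ### The quadratic order, its ideals, and its class group -/

/-- The imaginary quadratic order `𝒪 = ℤ[(D + √D) / 2] ⊆ ℂ` of discriminant `D`
(for a negative `D ≡ 0, 1 mod 4`). -/
abbrev QuadOrder (D : ℤ) : Subalgebra ℤ ℂ := Algebra.adjoin ℤ {((D : ℂ) + sqrtNeg D) / 2}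

/-- The group `I(𝒪)` of invertible fractional ideals of the order of discriminant `D`. -/
abbrev InvIdeals (D : ℤ) : Type := (FractionalIdeal (QuadOrder D)⁰ (FractionRing (QuadOrder D)))ˣ

/-- The class group `Cl(D)`: the classes of invertible fractional ideals of the order modulo
principal ones. The class of a form `Q` is `BinForm.toClass D Q` below, and this correspondence is
the one that turns composition of forms into the group law. -/
abbrev QuadClassGroup (D : ℤ) : Type := ClassGroup (QuadOrder D)

/-- The ideal `ℤ a + ℤ (b - √D) / 2` of the order attached to `Q = [a, b, c]` of discriminant `D`.
For such `Q` this lattice is already stable under the order, so it is the ideal generated by its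
two basis elements. -/
def BinForm.toIdeal (D : ℤ) (Q : BinForm) : Ideal (QuadOrder D) :=
  Ideal.span {x | (x : ℂ) = (Q.a : ℂ) ∨ (x : ℂ) = ((Q.b : ℂ) - sqrtNeg D) / 2}

theorem sqrtNeg_sq {D : ℤ} (hD : D < 0) : sqrtNeg D ^ 2 = (D : ℂ) := by
  have h : (0 : ℝ) ≤ -(D : ℝ) := by
    have : (D : ℝ) < 0 := by exact_mod_cast hD
    linarith
  rw [sqrtNeg, mul_pow, Complex.I_sq, ← Complex.ofReal_pow, Real.sq_sqrt h]
  push_cast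
  ring

/-- The ideal of a primitive form of discriminant `D < 0` is invertible. -/
theorem BinForm.isUnit_toIdeal {D : ℤ} (hD : D < 0) {Q : BinForm} (hQ : Q.IsPrimPosDef D) :
    IsUnit ((Q.toIdeal D : Ideal (QuadOrder D)) :
      FractionalIdeal (QuadOrder D)⁰ (FractionRing (QuadOrder D))) := by
  obtain ⟨hdisc, hprim, hpos⟩ := hQ
  unfold BinForm.disc at hdisc
  have hs := sqrtNeg_sq hD
  have hω : ((D : ℂ) + sqrtNeg D) / 2 ∈ QuadOrder D :=
    Algebra.subset_adjoin (Set.mem_singleton _)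
  have hint : ∀ n : ℤ, (n : ℂ) ∈ QuadOrder D := fun n => (QuadOrder D).intCast_mem n
  obtain ⟨t, ht⟩ : ∃ t : ℤ, Q.b + D = 2 * t := by
    have h : (2 : ℤ) ∣ Q.b * (Q.b + 1) := (Int.even_mul_succ_self Q.b).two_dvd
    obtain ⟨s, hs⟩ := h
    exact ⟨s - 2 * Q.a * Q.c, by rw [← hdisc]; linear_combination hs⟩
  have htC : (Q.b : ℂ) + D = 2 * t := by exact_mod_cast ht
  have hdC : (Q.b : ℂ) ^ 2 - 4 * Q.a * Q.c = D := by exact_mod_cast hdisc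
  have hr : ((Q.b : ℂ) - sqrtNeg D) / 2 ∈ QuadOrder D := by
    have h := (QuadOrder D).sub_mem (hint t) hω
    convert h using 1
    linear_combination (1 / 2 : ℂ) * htC
  have hr' : ((Q.b : ℂ) + sqrtNeg D) / 2 ∈ QuadOrder D := by
    have h := (QuadOrder D).add_mem (hint (t - D)) hω
    convert h using 1
    push_cast
    linear_combination (1 / 2 : ℂ) * htC
  let A : QuadOrder D := ⟨(Q.a : ℂ), hint Q.a⟩
  let B : QuadOrder D := ⟨(Q.b : ℂ), hint Q.b⟩
  let C : QuadOrder D := ⟨(Q.c : ℂ), hint Q.c⟩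
  let r : QuadOrder D := ⟨((Q.b : ℂ) - sqrtNeg D) / 2, hr⟩
  let r' : QuadOrder D := ⟨((Q.b : ℂ) + sqrtNeg D) / 2, hr'⟩
  have hsum : r + r' = B := Subtype.ext (by
    change ((Q.b : ℂ) - sqrtNeg D) / 2 + ((Q.b : ℂ) + sqrtNeg D) / 2 = (Q.b : ℂ)
    ring)
  have hprod : r * r' = A * C := Subtype.ext (by
    change ((Q.b : ℂ) - sqrtNeg D) / 2 * (((Q.b : ℂ) + sqrtNeg D) / 2) = (Q.a : ℂ) * (Q.c : ℂ)
    linear_combination (1 / 4 : ℂ) * hdC - (1 / 4 : ℂ) * hs)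
  obtain ⟨u, v, w, huvw⟩ : ∃ u v w : ℤ, Q.a * u + Q.b * v + Q.c * w = 1 := by
    have h1 := Int.gcd_eq_gcd_ab (Int.gcd Q.a Q.b : ℤ) Q.c
    have h2 := Int.gcd_eq_gcd_ab Q.a Q.b
    rw [hprim] at h1
    refine ⟨Int.gcdA Q.a Q.b * Int.gcdA (Int.gcd Q.a Q.b : ℤ) Q.c,
      Int.gcdB Q.a Q.b * Int.gcdA (Int.gcd Q.a Q.b : ℤ) Q.c,
      Int.gcdB (Int.gcd Q.a Q.b : ℤ) Q.c, ?_⟩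
    push_cast at h1
    linear_combination -h1 - Int.gcdA (Int.gcd Q.a Q.b : ℤ) Q.c * h2
  have hbez : A * (u : QuadOrder D) + B * (v : QuadOrder D) + C * (w : QuadOrder D) = 1 :=
    Subtype.ext (by
      change (Q.a : ℂ) * ((u : QuadOrder D) : ℂ) + (Q.b : ℂ) * ((v : QuadOrder D) : ℂ) +
        (Q.c : ℂ) * ((w : QuadOrder D) : ℂ) = 1
      push_cast
      exact_mod_cast huvw)
  have hset : Q.toIdeal D = Ideal.span {A, r} := by
    unfold BinForm.toIdeal
    congr 1
    ext x
    simp only [Set.mem_ofPred_eq, Set.mem_insert_iff, Set.mem_singleton_iff, Subtype.ext_iff]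
    rfl
  have hmul : Q.toIdeal D * Ideal.span {A, r'} = Ideal.span {A} := by
    rw [hset, Ideal.span_pair_mul_span_pair]
    apply le_antisymm
    · rw [Ideal.span_le]
      rintro x (rfl | rfl | rfl | rfl)
      · exact Ideal.mem_span_singleton'.2 ⟨A, rfl⟩
      · exact Ideal.mem_span_singleton'.2 ⟨r', mul_comm _ _⟩
      · exact Ideal.mem_span_singleton'.2 ⟨r, rfl⟩
      · exact Ideal.mem_span_singleton'.2 ⟨C, by rw [hprod]; ring⟩
    · rw [Ideal.span_singleton_le_iff_mem]
      set S := Ideal.span {A * A, A * r', r * A, r * r'} with hS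
      have m1 : A * A ∈ S := Ideal.subset_span (by simp)
      have m2 : A * r' ∈ S := Ideal.subset_span (by simp)
      have m3 : r * A ∈ S := Ideal.subset_span (by simp)
      have m4 : r * r' ∈ S := Ideal.subset_span (by simp)
      have h := S.add_mem (S.add_mem (S.mul_mem_right (u : QuadOrder D) m1)
        (S.mul_mem_right (v : QuadOrder D) (S.add_mem m2 m3)))
        (S.mul_mem_right (w : QuadOrder D) m4)
      convert h using 1
      rw [hprod]
      linear_combination -A * hbez - A * (v : QuadOrder D) * hsum
  have hA : A ≠ 0 := by
    intro h
    have h1 : (Q.a : ℂ) = 0 := congrArg Subtype.val h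
    exact hpos.ne' (by exact_mod_cast h1)
  have hAu : IsUnit ((Ideal.span {A} : Ideal (QuadOrder D)) :
      FractionalIdeal (QuadOrder D)⁰ (FractionRing (QuadOrder D))) := by
    rw [FractionalIdeal.coeIdeal_span_singleton]
    have hA' : algebraMap (QuadOrder D) (FractionRing (QuadOrder D)) A ≠ 0 := by
      simpa using hA
    refine IsUnit.of_mul_eq_one (FractionalIdeal.spanSingleton _
      (algebraMap (QuadOrder D) (FractionRing (QuadOrder D)) A)⁻¹) ?_
    rw [FractionalIdeal.spanSingleton_mul_spanSingleton, mul_inv_cancel₀ hA',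
      FractionalIdeal.spanSingleton_one]
  rw [← hmul, FractionalIdeal.coeIdeal_mul] at hAu
  exact isUnit_of_mul_isUnit_left hAu

open Classical in
/-- The ideal of `Q` as an element of `I(𝒪)`; the default value `1` is never used for a primitive
form of discriminant `D < 0`, by `BinForm.isUnit_toIdeal`. -/
def BinForm.toInvIdeal (D : ℤ) (Q : BinForm) : InvIdeals D :=
  if h : IsUnit ((Q.toIdeal D : Ideal (QuadOrder D)) :
      FractionalIdeal (QuadOrder D)⁰ (FractionRing (QuadOrder D))) then h.unit else 1

/-- The class in `Cl(D)` of a form `Q`. -/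
def BinForm.toClass (D : ℤ) (Q : BinForm) : QuadClassGroup D :=
  ClassGroup.mk (FractionRing (QuadOrder D)) (Q.toInvIdeal D)

/-- The value at (the class of) `Q` of a character `φ : Cl(D) → {±1}`. -/
def charVal {D : ℤ} (φ : QuadClassGroup D →* ℤˣ) (Q : BinForm) : ℂ := ((φ (Q.toClass D) : ℤ) : ℂ)

/-! ### Hecke characters and their forms -/

/-- A Hecke character of `∞`-type `ℓ` of the order of discriminant `D`: a homomorphism
`I(𝒪) → ℂˣ` sending `α 𝒪` to `α ^ ℓ`. -/
structure OrderHeckeChar (D : ℤ) (ℓ : ℕ) where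
  toHom : InvIdeals D →* ℂˣ
  map_principal : ∀ (α : QuadOrder D) (u : InvIdeals D),
    (u : FractionalIdeal (QuadOrder D)⁰ (FractionRing (QuadOrder D))) =
      ((Ideal.span {α} : Ideal (QuadOrder D)) :
        FractionalIdeal (QuadOrder D)⁰ (FractionRing (QuadOrder D))) →
    (toHom u : ℂ) = (α : ℂ) ^ ℓ

/-- The invertible integral ideals `𝔟 ⊆ 𝒪` of norm `|𝒪 / 𝔟| = N`. -/
def integralOfNorm (D : ℤ) (N : ℕ) : Set (InvIdeals D) :=
  {u | ∃ 𝔟 : Ideal (QuadOrder D),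
    (u : FractionalIdeal (QuadOrder D)⁰ (FractionRing (QuadOrder D))) = 𝔟 ∧
      Nat.card (QuadOrder D ⧸ 𝔟) = N}

/-- The coefficient of `q ^ N`, `N ≥ 1`, in `f_Φ = ∑_𝔟 Φ(𝔟) q ^ N(𝔟)`, the sum being over the
invertible integral ideals `𝔟` of the order. -/
def heckeForm {D : ℤ} {ℓ : ℕ} (Φ : OrderHeckeChar D ℓ) (N : ℕ) : ℂ :=
  ∑ᶠ u ∈ integralOfNorm D N, (Φ.toHom u : ℂ)

/-- A character `φ : Cl(D) → {±1}` as a Hecke character of `∞`-type `0`. -/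
def charToHecke {D : ℤ} (φ : QuadClassGroup D →* ℤˣ) : OrderHeckeChar D 0 where
  toHom := ((Units.map (Int.castRingHom ℂ).toMonoidHom).comp φ).comp
    (ClassGroup.mk (FractionRing (QuadOrder D)))
  map_principal := by
    intro α u hu
    have hα : α ≠ 0 := by
      rintro rfl
      exact u.ne_zero (by rw [hu]; simp)
    have h : ClassGroup.mk (FractionRing (QuadOrder D)) u = 1 :=
      (ClassGroup.mk_eq_one_of_coe_ideal hu).2 ⟨α, hα, rfl⟩
    simp [h]

/-- The coefficients of `f_{φ,1} = w ∑_𝔟 φ([𝔟]) q ^ N(𝔟)`, where `w` is the number of units of the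
order. (The constant term plays no role in the `L`-function.) -/
def weightOneForm {D : ℤ} (φ : QuadClassGroup D →* ℤˣ) (N : ℕ) : ℂ :=
  (Nat.card (QuadOrder D)ˣ : ℂ) * heckeForm (charToHecke φ) N

/-- The coefficients of `f_{φ,3} = ∑_{d ∈ δ} φ(Q_{/d}) Θ_{Q_{/d}}`. -/
def weightThreeForm {D : ℤ} (φ : QuadClassGroup D →* ℤˣ) (Q : BinForm) (δ : Finset ℕ) (N : ℕ) :
    ℂ :=
  ∑ d ∈ δ, charVal φ (Q.divBy d) * thetaThree (Q.divBy d) N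

end

noncomputable section

open ComplexConjugate

/-! To F = [A, B, C] of discriminant D belongs the lattice with basis A, ρ = (B - √D)/2. Its points
α = Ax + ρy satisfy αᾱ = A·F(x, y), so sums over the lattice are sums over values of F.

Analytic side. For F = Q_{/d} one has A = a/d and dτA = -ρ, so (m, n) = (-y, x) turns dmτ + n into
α/A. With N = F(x, y), the term of H_d becomes A(α² + ᾱ²)/N³ + A²/N². Since A divides B, F has the
automorph (x, y) ↦ (-x - κy, y) with κ = B/A, which sends α to -ᾱ. For W = (Ax² - Cy²)/2 it gives α²
+ ᾱ² = 2A(W + W∘reflection) (`point_sq_add_conj_sq`). Summation yields H_d = 4A² L(Θ_F, 3) + A²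
L(θ_F, 2) (`hasSum_kroneckerTerm`). Since d²A² = a² and Im τ = √|D|/(2a), the factor in front no
longer depends on d.

Arithmetic side. If u·I(F) = α𝒪 with α in I(F), then u is integral of norm F(x, y), and u determines
α up to units. As F runs over representatives of the classes, every invertible integral ideal
arises. Hence w·f_Ψ is a sum of series ∑ α^ℓ Ψ(I(F))⁻¹ q^F (`card_units_mul_heckeForm`). For ℓ = 0
these are the series φ(F) θ_F. For ℓ = 2 the reflection replaces ∑ α² by 2A times a coefficient of
Θ_F, and Φ(I(F)) = φ(F)A and w = 2 remove the constants. This rests on the dictionary between form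
classes and ideal classes (`toClass_eq_iff`, `exists_toClass_eq`). -/

theorem conj_sqrtNeg (D : ℤ) : conj (sqrtNeg D) = -sqrtNeg D := by
  simp [sqrtNeg]

theorem sqrtNeg_im_pos {D : ℤ} (hD : D < 0) : 0 < (sqrtNeg D).im := by
  have h : (0 : ℝ) < -(D : ℝ) := by
    have : (D : ℝ) < 0 := by exact_mod_cast hD
    linarith
  simpa [sqrtNeg] using Real.sqrt_pos.2 h

theorem sqrtNeg_ne_zero {D : ℤ} (hD : D < 0) : sqrtNeg D ≠ 0 := fun h =>
  (sqrtNeg_im_pos hD).ne' (by rw [h]; rfl)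

/-! ### The order and the ideal of a form as explicit lattices -/

namespace BinForm

/-- The second basis element `(b - √D) / 2` of the ideal attached to a form. -/
def root (D : ℤ) (F : BinForm) : ℂ := ((F.b : ℂ) - sqrtNeg D) / 2

/-- The point `a x + y (b - √D) / 2` of the lattice attached to a form. -/
def point (D : ℤ) (F : BinForm) (p : ℤ × ℤ) : ℂ := F.a * p.1 + p.2 * F.root D

/-- The form `[a, -b, c]`. -/
def opp (F : BinForm) : BinForm := ⟨F.a, -F.b, F.c⟩

theorem conj_root (D : ℤ) (F : BinForm) : conj (F.root D) = F.b - F.root D := by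
  simp only [root, map_div₀, map_sub, conj_sqrtNeg, map_intCast, map_ofNat]
  ring

theorem disc_opp (F : BinForm) : F.opp.disc = F.disc := by
  simp [opp, disc]

theorem IsPrimPosDef.opp {D : ℤ} {F : BinForm} (hF : F.IsPrimPosDef D) : F.opp.IsPrimPosDef D :=
  ⟨by rw [disc_opp, hF.disc_eq], by simpa [BinForm.opp] using hF.primitive, hF.pos⟩

theorem IsPrimPosDef.c_pos {D : ℤ} (hD : D < 0) {F : BinForm} (hF : F.IsPrimPosDef D) :
    0 < F.c := by
  have h := hF.disc_eq
  have ha := hF.pos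
  unfold disc at h
  by_contra! hc
  nlinarith [sq_nonneg F.b, mul_nonneg ha.le (neg_nonneg.2 hc)]

theorem exists_b_add_eq_two_mul {D : ℤ} {F : BinForm} (hF : F.disc = D) : ∃ t : ℤ, F.b + D = 2 * t := by
  obtain ⟨s, hs⟩ : (2 : ℤ) ∣ F.b * (F.b + 1) := (Int.even_mul_succ_self F.b).two_dvd
  exact ⟨s - 2 * F.a * F.c, by rw [← hF, disc]; linear_combination hs⟩

variable {D : ℤ} {F : BinForm}

theorem root_sq (hD : D < 0) (hF : F.disc = D) :
    F.root D ^ 2 = F.b * F.root D - F.a * F.c := by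
  have hs := sqrtNeg_sq hD
  have hdC : (F.b : ℂ) ^ 2 - 4 * F.a * F.c = D := by exact_mod_cast hF
  rw [root]
  linear_combination (1 / 4 : ℂ) * hs - (1 / 4 : ℂ) * hdC

theorem root_mem (hF : F.disc = D) : F.root D ∈ QuadOrder D := by
  obtain ⟨t, ht⟩ := exists_b_add_eq_two_mul hF
  have htC : (F.b : ℂ) + D = 2 * t := by exact_mod_cast ht
  have h := (QuadOrder D).sub_mem ((QuadOrder D).intCast_mem t)
    (Algebra.subset_adjoin (Set.mem_singleton (((D : ℂ) + sqrtNeg D) / 2)))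
  convert h using 1
  rw [root]
  linear_combination (1 / 2 : ℂ) * htC

/-- The generator (D + √D)/2 equals t - ρ with 2t = b + D, and ρ² = bρ - ac closes the span of 1, ρ
under products. Thus each form of discriminant D supplies its own basis of the order. -/
theorem mem_quadOrder_iff (hD : D < 0) (hF : F.disc = D) {z : ℂ} :
    z ∈ QuadOrder D ↔ ∃ x y : ℤ, z = x + y * F.root D := by
  constructor
  · intro hz
    induction hz using Algebra.adjoin_induction with
    | mem u hu =>
      rw [Set.mem_singleton_iff] at hu
      obtain ⟨t, ht⟩ := exists_b_add_eq_two_mul hF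
      have htC : (F.b : ℂ) + D = 2 * t := by exact_mod_cast ht
      refine ⟨t, -1, ?_⟩
      rw [hu, root]
      push_cast
      linear_combination (1 / 2 : ℂ) * htC
    | algebraMap n => exact ⟨n, 0, by simp⟩
    | add u v _ _ hu hv =>
      obtain ⟨x, y, rfl⟩ := hu
      obtain ⟨x', y', rfl⟩ := hv
      exact ⟨x + x', y + y', by push_cast; ring⟩
    | mul u v _ _ hu hv =>
      obtain ⟨x, y, rfl⟩ := hu
      obtain ⟨x', y', rfl⟩ := hv
      refine ⟨x * x' - y * y' * F.a * F.c, x * y' + x' * y + y * y' * F.b, ?_⟩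
      push_cast
      linear_combination (y * y' : ℂ) * root_sq hD hF
  · rintro ⟨x, y, rfl⟩
    exact add_mem ((QuadOrder D).intCast_mem x)
      (mul_mem ((QuadOrder D).intCast_mem y) (root_mem hF))

/-- No 𝒪-span is needed beyond the ℤ-span of a and ρ: by ρ² = bρ - ac, multiplication by ρ acts on
coordinates as (x, y) ↦ (-cy, ax + by). -/
theorem mem_toIdeal_iff (hD : D < 0) (hF : F.disc = D) {z : QuadOrder D} :
    z ∈ F.toIdeal D ↔ ∃ p : ℤ × ℤ, (z : ℂ) = F.point D p := by
  constructor
  · intro hz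
    unfold toIdeal at hz
    induction hz using Submodule.span_induction with
    | mem u hu =>
      rcases hu with hu | hu
      · exact ⟨(1, 0), by simp [point, hu]⟩
      · exact ⟨(0, 1), by simp [point, hu, root]⟩
    | zero => exact ⟨0, by simp [point]⟩
    | add u v _ _ hu hv =>
      obtain ⟨p, hp⟩ := hu
      obtain ⟨p', hp'⟩ := hv
      refine ⟨p + p', ?_⟩
      rw [AddMemClass.coe_add, hp, hp']
      simp only [point, Prod.fst_add, Prod.snd_add]
      push_cast
      ring
    | smul u v _ hv =>
      obtain ⟨⟨x, y⟩, hp⟩ := hv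
      obtain ⟨m, n, hmn⟩ := (mem_quadOrder_iff hD hF).1 u.2
      refine ⟨(m * x - n * y * F.c, m * y + n * (F.a * x + F.b * y)), ?_⟩
      rw [smul_eq_mul, MulMemClass.coe_mul, hp, hmn]
      simp only [point]
      push_cast
      linear_combination (n * y : ℂ) * root_sq hD hF
  · rintro ⟨⟨x, y⟩, hp⟩
    have hz : z = (x : QuadOrder D) * ⟨F.a, (QuadOrder D).intCast_mem F.a⟩ +
        (y : QuadOrder D) * ⟨F.root D, root_mem hF⟩ := Subtype.ext (by
      rw [hp, AddMemClass.coe_add, MulMemClass.coe_mul, MulMemClass.coe_mul]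
      simp [point]
      ring)
    rw [hz]
    refine add_mem (Ideal.mul_mem_left _ _ (Ideal.subset_span (Or.inl rfl)))
      (Ideal.mul_mem_left _ _ (Ideal.subset_span (Or.inr rfl)))

theorem root_im (D : ℤ) (F : BinForm) : (F.root D).im = -(sqrtNeg D).im / 2 := by
  simp [root]

theorem eq_of_add_mul_root_eq (hD : D < 0) {x y x' y' : ℝ}
    (h : (x : ℂ) + y * F.root D = x' + y' * F.root D) : x = x' ∧ y = y' := by
  have him := congrArg Complex.im h
  simp only [Complex.add_im, Complex.ofReal_im, zero_add, Complex.im_ofReal_mul] at him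
  have hr : (F.root D).im ≠ 0 := by
    rw [root_im]
    have := sqrtNeg_im_pos hD
    intro h0
    linarith
  have hy : y = y' := mul_right_cancel₀ hr him
  subst hy
  exact ⟨by exact_mod_cast add_right_cancel h, rfl⟩

theorem point_injective (hD : D < 0) (ha : 0 < F.a) : Function.Injective (F.point D) := by
  rintro ⟨x, y⟩ ⟨x', y'⟩ h
  have h' : (((F.a * x : ℤ) : ℝ) : ℂ) + ((y : ℝ) : ℂ) * F.root D =
      (((F.a * x' : ℤ) : ℝ) : ℂ) + ((y' : ℝ) : ℂ) * F.root D := by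
    simpa [point] using h
  obtain ⟨h1, h2⟩ := eq_of_add_mul_root_eq hD h'
  have h1' : F.a * x = F.a * x' := by exact_mod_cast h1
  rw [mul_left_cancel₀ ha.ne' h1', (by exact_mod_cast h2 : y = y')]

theorem point_mul_conj (hD : D < 0) (hF : F.disc = D) (p : ℤ × ℤ) :
    F.point D p * conj (F.point D p) = F.a * F.eval p.1 p.2 := by
  simp only [point, eval, map_add, map_mul, map_intCast, conj_root]
  push_cast
  linear_combination (-(p.2 : ℂ) ^ 2) * root_sq hD hF

theorem normSq_point (hD : D < 0) (hF : F.disc = D) (p : ℤ × ℤ) :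
    Complex.normSq (F.point D p) = F.a * F.eval p.1 p.2 := by
  have h := point_mul_conj hD hF p
  rw [Complex.mul_conj] at h
  exact_mod_cast h

theorem toIdeal_eq_span (hF : F.disc = D) : F.toIdeal D =
    Ideal.span {(F.a : QuadOrder D), ⟨F.root D, root_mem hF⟩} := by
  unfold toIdeal
  congr 1
  ext x
  simp only [Set.mem_ofPred_eq, Set.mem_insert_iff, Set.mem_singleton_iff, Subtype.ext_iff]
  simp [root]

/-- The root of the opposite form is r' = -ρ̄, so its ideal is the conjugate one. The product
contains a·a, a(r - r') = ab and rr' = -ac, hence a itself by primitivity. -/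
theorem toIdeal_mul_toIdeal_opp (hD : D < 0) (hF : F.IsPrimPosDef D) :
    F.toIdeal D * F.opp.toIdeal D = Ideal.span {(F.a : QuadOrder D)} := by
  have hd := hF.disc_eq
  have hd' : F.opp.disc = D := by rw [disc_opp, hd]
  set r : QuadOrder D := ⟨F.root D, root_mem hd⟩ with hr
  set r' : QuadOrder D := ⟨F.opp.root D, root_mem hd'⟩ with hr'
  have hsub : r - r' = F.b := Subtype.ext (by
    simp [hr, hr', root, BinForm.opp]; ring)
  have hprod : r * r' = -(F.a * F.c : QuadOrder D) := Subtype.ext (by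
    have h1 : F.opp.root D = F.root D - F.b := by simp [root, BinForm.opp]; ring
    simp only [hr, hr', MulMemClass.coe_mul, h1, NegMemClass.coe_neg]
    simp
    linear_combination root_sq hD hd)
  obtain ⟨u, v, w, huvw⟩ : ∃ u v w : ℤ, F.a * u + F.b * v + F.c * w = 1 := by
    have h1 := Int.gcd_eq_gcd_ab (Int.gcd F.a F.b : ℤ) F.c
    have h2 := Int.gcd_eq_gcd_ab F.a F.b
    rw [hF.primitive] at h1
    refine ⟨Int.gcdA F.a F.b * Int.gcdA (Int.gcd F.a F.b : ℤ) F.c,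
      Int.gcdB F.a F.b * Int.gcdA (Int.gcd F.a F.b : ℤ) F.c,
      Int.gcdB (Int.gcd F.a F.b : ℤ) F.c, ?_⟩
    push_cast at h1
    linear_combination -h1 - Int.gcdA (Int.gcd F.a F.b : ℤ) F.c * h2
  have hbez : (F.a : QuadOrder D) * u + F.b * v + F.c * w = 1 := by exact_mod_cast huvw
  rw [toIdeal_eq_span hd, toIdeal_eq_span hd', Ideal.span_pair_mul_span_pair]
  change Ideal.span {(F.a : QuadOrder D) * F.a, (F.a : QuadOrder D) * r', r * F.a, r * r'} = _
  apply le_antisymm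
  · rw [Ideal.span_le]
    rintro x (rfl | rfl | rfl | rfl)
    · exact Ideal.mem_span_singleton'.2 ⟨F.a, rfl⟩
    · exact Ideal.mem_span_singleton'.2 ⟨r', mul_comm _ _⟩
    · exact Ideal.mem_span_singleton'.2 ⟨r, rfl⟩
    · exact Ideal.mem_span_singleton'.2 ⟨-F.c, by rw [hprod]; ring⟩
  · rw [Ideal.span_singleton_le_iff_mem]
    set S := Ideal.span {(F.a : QuadOrder D) * F.a, (F.a : QuadOrder D) * r', r * F.a, r * r'}
      with hS
    have m1 : (F.a : QuadOrder D) * F.a ∈ S := Ideal.subset_span (by simp)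
    have m2 : (F.a : QuadOrder D) * r' ∈ S := Ideal.subset_span (by simp)
    have m3 : r * F.a ∈ S := Ideal.subset_span (by simp)
    have m4 : r * r' ∈ S := Ideal.subset_span (by simp)
    have h := S.sub_mem (S.add_mem (S.mul_mem_right (u : QuadOrder D) m1)
      (S.mul_mem_right (v : QuadOrder D) (S.sub_mem m3 m2)))
      (S.mul_mem_right (w : QuadOrder D) m4)
    convert h using 1
    rw [hprod]
    linear_combination -(F.a : QuadOrder D) * hbez - (F.a : QuadOrder D) * v * hsub

end BinForm

/-! ### Norms of ideals as indices -/

theorem Ideal.card_quotient_eq_index {R : Type*} [CommRing R] (I : Ideal R) :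
    Nat.card (R ⧸ I) = I.toAddSubgroup.index := rfl

/-- Multiplication by x is injective, so the index of xJ in xR is that of J in R; then indices
multiply along xJ ⊆ xR ⊆ R. -/
theorem Ideal.card_quotient_span_singleton_mul {R : Type*} [CommRing R] [IsDomain R] {x : R}
    (hx : x ≠ 0) (J : Ideal R) :
    Nat.card (R ⧸ Ideal.span {x} * J) = Nat.card (R ⧸ Ideal.span {x}) * Nat.card (R ⧸ J) := by
  have hinj : Function.Injective (AddMonoidHom.mulLeft x) := fun u v h => mul_left_cancel₀ hx h
  have h1 : (Ideal.span {x} * J).toAddSubgroup = J.toAddSubgroup.map (AddMonoidHom.mulLeft x) := by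
    ext z
    simp [Ideal.mem_span_singleton_mul]
  have h2 : (Ideal.span {x}).toAddSubgroup =
      (⊤ : AddSubgroup R).map (AddMonoidHom.mulLeft x) := by
    ext z
    simp [Ideal.mem_span_singleton', mul_comm]
  have h3 := AddSubgroup.relIndex_map_map_of_injective J.toAddSubgroup ⊤ hinj
  rw [← h1, ← h2, AddSubgroup.relIndex_top_right] at h3
  have h4 := AddSubgroup.relIndex_mul_index
    (show (Ideal.span {x} * J).toAddSubgroup ≤ (Ideal.span {x}).toAddSubgroup from
      Ideal.mul_le_left)
  rw [h3] at h4
  rw [Ideal.card_quotient_eq_index, Ideal.card_quotient_eq_index, Ideal.card_quotient_eq_index,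
    ← h4, mul_comm]

namespace BinForm

variable {D : ℤ} {F : BinForm}

/-- The coordinates of the order of discriminant `D` with respect to the basis `1, (b - √D) / 2`. -/
def basisEquiv (hD : D < 0) (hF : F.disc = D) : ℤ × ℤ ≃+ QuadOrder D :=
  AddEquiv.ofBijective
    (AddMonoidHom.mk' (fun p : ℤ × ℤ => (⟨p.1 + p.2 * F.root D,
      (mem_quadOrder_iff hD hF).2 ⟨p.1, p.2, rfl⟩⟩ : QuadOrder D)) (fun p q => Subtype.ext (by
        simp; ring)))
    ⟨by
      rintro ⟨x, y⟩ ⟨x', y'⟩ h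
      have h' := congrArg Subtype.val h
      have h2 : ((x : ℝ) : ℂ) + ((y : ℝ) : ℂ) * F.root D = ((x' : ℝ) : ℂ) + ((y' : ℝ) : ℂ) *
        F.root D := by simpa using h'
      obtain ⟨h3, h4⟩ := eq_of_add_mul_root_eq hD h2
      rw [Prod.mk.injEq]
      exact ⟨by exact_mod_cast h3, by exact_mod_cast h4⟩, by
      rintro ⟨z, hz⟩
      obtain ⟨x, y, rfl⟩ := (mem_quadOrder_iff hD hF).1 hz
      exact ⟨(x, y), rfl⟩⟩

theorem coe_basisEquiv (hD : D < 0) (hF : F.disc = D) (p : ℤ × ℤ) :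
    (basisEquiv hD hF p : ℂ) = p.1 + p.2 * F.root D := rfl

/-- In the basis 1, ρ the ideal is aℤ × ℤ, the kernel of the first coordinate modulo a. -/
theorem card_quotient_toIdeal (hD : D < 0) (hF : F.disc = D) :
    Nat.card (QuadOrder D ⧸ F.toIdeal D) = F.a.natAbs := by
  set e := basisEquiv hD hF
  let f : ℤ × ℤ →+ ZMod F.a.natAbs :=
    (Int.castAddHom (ZMod F.a.natAbs)).comp (AddMonoidHom.fst ℤ ℤ)
  have hker : (F.toIdeal D).toAddSubgroup = (f.comp e.symm.toAddMonoidHom).ker := by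
    ext z
    obtain ⟨p, rfl⟩ := e.surjective z
    rw [AddMonoidHom.mem_ker]
    change e p ∈ F.toIdeal D ↔ ((e.symm (e p)).1 : ZMod F.a.natAbs) = 0
    rw [e.symm_apply_apply, ZMod.intCast_zmod_eq_zero_iff_dvd, Int.natAbs_dvd,
      mem_toIdeal_iff hD hF]
    constructor
    · rintro ⟨q, hq⟩
      have h : e p = e (F.a * q.1, q.2) := Subtype.ext (by
        rw [hq, coe_basisEquiv]
        simp [point])
      exact ⟨q.1, by rw [e.injective h]⟩
    · rintro ⟨x, hx⟩
      exact ⟨(x, p.2), by rw [coe_basisEquiv, hx]; simp [point]⟩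
  have hsurj : Function.Surjective (f.comp e.symm.toAddMonoidHom) := fun z => by
    obtain ⟨n, rfl⟩ := ZMod.intCast_surjective z
    exact ⟨e (n, 0), by
      change ((e.symm (e (n, 0))).1 : ZMod F.a.natAbs) = n
      rw [e.symm_apply_apply]⟩
  rw [Ideal.card_quotient_eq_index, hker, AddSubgroup.index_ker,
    AddMonoidHom.range_eq_top.2 hsurj, Nat.card_congr AddSubgroup.topEquiv.toEquiv, Nat.card_zmod]

theorem card_quotient_span_intCast (hD : D < 0) (hF : F.disc = D) (m : ℤ) :
    Nat.card (QuadOrder D ⧸ Ideal.span {(m : QuadOrder D)}) = m.natAbs ^ 2 := by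
  set e := basisEquiv hD hF
  let f : ℤ × ℤ →+ ZMod m.natAbs × ZMod m.natAbs :=
    (Int.castAddHom (ZMod m.natAbs)).prodMap (Int.castAddHom (ZMod m.natAbs))
  have hker : (Ideal.span {(m : QuadOrder D)}).toAddSubgroup =
      (f.comp e.symm.toAddMonoidHom).ker := by
    ext z
    obtain ⟨p, rfl⟩ := e.surjective z
    rw [AddMonoidHom.mem_ker]
    change e p ∈ Ideal.span {(m : QuadOrder D)} ↔
      (((e.symm (e p)).1 : ZMod m.natAbs), ((e.symm (e p)).2 : ZMod m.natAbs)) = 0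
    rw [e.symm_apply_apply, Prod.mk_eq_zero, ZMod.intCast_zmod_eq_zero_iff_dvd,
      ZMod.intCast_zmod_eq_zero_iff_dvd, Int.natAbs_dvd, Int.natAbs_dvd,
      Ideal.mem_span_singleton']
    constructor
    · rintro ⟨u, hu⟩
      obtain ⟨q, rfl⟩ := e.surjective u
      have h : e p = e (m * q.1, m * q.2) := Subtype.ext (by
        rw [← hu, MulMemClass.coe_mul, coe_basisEquiv, coe_basisEquiv]
        push_cast
        ring)
      rw [e.injective h]
      exact ⟨⟨q.1, rfl⟩, ⟨q.2, rfl⟩⟩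
    · rintro ⟨⟨x, hx⟩, ⟨y, hy⟩⟩
      refine ⟨e (x, y), Subtype.ext ?_⟩
      rw [MulMemClass.coe_mul, coe_basisEquiv, coe_basisEquiv, hx, hy]
      push_cast
      ring
  have hsurj : Function.Surjective (f.comp e.symm.toAddMonoidHom) := fun z => by
    obtain ⟨n, hn⟩ := ZMod.intCast_surjective z.1
    obtain ⟨n', hn'⟩ := ZMod.intCast_surjective z.2
    exact ⟨e (n, n'), by
      change (((e.symm (e (n, n'))).1 : ZMod m.natAbs),
        ((e.symm (e (n, n'))).2 : ZMod m.natAbs)) = z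
      rw [e.symm_apply_apply, hn, hn']⟩
  rw [Ideal.card_quotient_eq_index, hker, AddSubgroup.index_ker,
    AddMonoidHom.range_eq_top.2 hsurj, Nat.card_congr AddSubgroup.topEquiv.toEquiv, Nat.card_prod,
    Nat.card_zmod, sq]

theorem conj_mem (hD : D < 0) (hF : F.disc = D) {z : ℂ} (hz : z ∈ QuadOrder D) :
    conj z ∈ QuadOrder D := by
  obtain ⟨x, y, rfl⟩ := (mem_quadOrder_iff hD hF).1 hz
  refine (mem_quadOrder_iff hD hF).2 ⟨x + y * F.b, -y, ?_⟩
  simp only [map_add, map_mul, map_intCast, conj_root]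
  push_cast
  ring

/-- Complex conjugation on the order of discriminant `D`. -/
def conjEquiv (hD : D < 0) (hF : F.disc = D) : QuadOrder D ≃+* QuadOrder D where
  toFun z := ⟨conj (z : ℂ), conj_mem hD hF z.2⟩
  invFun z := ⟨conj (z : ℂ), conj_mem hD hF z.2⟩
  left_inv z := Subtype.ext (by simp)
  right_inv z := Subtype.ext (by simp)
  map_mul' u v := Subtype.ext (by simp)
  map_add' u v := Subtype.ext (by simp)

/-- Conjugation gives x and x̄ the same index, and the product of the two indices is that of xx̄ =
N, namely N². -/
theorem card_quotient_span_singleton (hD : D < 0) (hF : F.disc = D) {x : QuadOrder D}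
    (hx : x ≠ 0) {N : ℕ} (hN : Complex.normSq x = N) :
    Nat.card (QuadOrder D ⧸ Ideal.span {x}) = N := by
  set x' : QuadOrder D := conjEquiv hD hF x with hx'
  have h1 : Nat.card (QuadOrder D ⧸ Ideal.span {x}) =
      Nat.card (QuadOrder D ⧸ Ideal.span {x'}) :=
    Nat.card_congr (Ideal.quotientEquiv _ _ (conjEquiv hD hF) (by
      rw [Ideal.map_span, Set.image_singleton]; rfl)).toEquiv
  have h2 : x * x' = ((N : ℤ) : QuadOrder D) := Subtype.ext (by
    change (x : ℂ) * conj (x : ℂ) = _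
    rw [Complex.mul_conj, hN]
    simp)
  have h3 := Ideal.card_quotient_span_singleton_mul hx (Ideal.span {x'})
  rw [Ideal.span_singleton_mul_span_singleton, h2, card_quotient_span_intCast hD hF, ← h1,
    ← sq, Int.natAbs_natCast] at h3
  exact (Nat.pow_left_injective (n := 2) two_ne_zero h3).symm

/-! ### Proper equivalence of forms and ideal classes -/

variable {G : BinForm}

/-- The element `a x + y (b - √D) / 2` of the order of discriminant `D`. -/
def elem (hF : F.disc = D) (p : ℤ × ℤ) : QuadOrder D :=
  ⟨F.point D p, add_mem (mul_mem ((QuadOrder D).intCast_mem _) ((QuadOrder D).intCast_mem _))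
    (mul_mem ((QuadOrder D).intCast_mem _) (root_mem hF))⟩

theorem coe_elem (hF : F.disc = D) (p : ℤ × ℤ) : (elem hF p : ℂ) = F.point D p := rfl

theorem elem_mem (hD : D < 0) (hF : F.disc = D) (p : ℤ × ℤ) : elem hF p ∈ F.toIdeal D :=
  (mem_toIdeal_iff hD hF).2 ⟨p, rfl⟩

/-- The matrix expresses the multiples by x of the basis of I(F) in the multiples by y of the basis
of I(G). Its determinant is read off from the alternating form (u, v) ↦ vū - v̄u, whose value on the
basis a, ρ is -a√D. -/
theorem exists_matrix_of_span_mul_le (hD : D < 0) (hF : F.disc = D) (hG : G.disc = D)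
    {x y : QuadOrder D}
    (h : Ideal.span {x} * F.toIdeal D ≤ Ideal.span {y} * G.toIdeal D) :
    ∃ p q r s : ℤ, (∀ X Y : ℤ, (x : ℂ) * F.point D (X, Y) =
        y * G.point D (p * X + q * Y, r * X + s * Y)) ∧
      ((p * s - q * r : ℤ) : ℝ) * (G.a * Complex.normSq y) = F.a * Complex.normSq x := by
  have key : ∀ v : ℤ × ℤ, ∃ w : ℤ × ℤ, (x : ℂ) * F.point D v = y * G.point D w := by
    intro v
    obtain ⟨z, hz, hzy⟩ := Ideal.mem_span_singleton_mul.1 (h (Ideal.mul_mem_mul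
      (Ideal.mem_span_singleton_self x) (elem_mem hD hF v)))
    obtain ⟨w, hw⟩ := (mem_toIdeal_iff hD hG).1 hz
    refine ⟨w, ?_⟩
    rw [← hw, ← coe_elem hF, ← MulMemClass.coe_mul, ← MulMemClass.coe_mul, hzy]
  obtain ⟨⟨p, r⟩, h1⟩ := key (1, 0)
  obtain ⟨⟨q, s⟩, h2⟩ := key (0, 1)
  simp only [point, Int.cast_one, Int.cast_zero, mul_one, mul_zero, zero_mul, one_mul, add_zero,
    zero_add] at h1 h2
  refine ⟨p, q, r, s, fun X Y => ?_, ?_⟩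
  · simp only [point]
    push_cast
    linear_combination (X : ℂ) * h1 + (Y : ℂ) * h2
  · have h1' := congrArg conj h1
    have h2' := congrArg conj h2
    simp only [map_add, map_mul, map_intCast, conj_root] at h1' h2'
    have hx := Complex.mul_conj (x : ℂ)
    have hy := Complex.mul_conj (y : ℂ)
    have hrF : 2 * F.root D = F.b - sqrtNeg D := by rw [root]; ring
    have hrG : 2 * G.root D = G.b - sqrtNeg D := by rw [root]; ring
    have h3 : sqrtNeg D * (((p * s - q * r : ℤ) : ℂ) * (G.a * (Complex.normSq y : ℂ))) =
        sqrtNeg D * (F.a * (Complex.normSq x : ℂ)) := by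
      rw [← hx, ← hy]
      push_cast
      have e1 : (x : ℂ) * F.root D * (conj (x : ℂ) * F.a) -
          conj (x : ℂ) * (F.b - F.root D) * (x * F.a) =
          (y : ℂ) * (G.a * q + s * G.root D) * (conj (y : ℂ) * (G.a * p + r * (G.b - G.root D))) -
          conj (y : ℂ) * (G.a * q + s * (G.b - G.root D)) * (y * (G.a * p + r * G.root D)) := by
        rw [h1', h2', h1, h2]
      linear_combination e1 - x * conj (x : ℂ) * F.a * hrF +
        y * conj (y : ℂ) * G.a * (p * s - q * r) * hrG
    have h4 := mul_left_cancel₀ (sqrtNeg_ne_zero hD) h3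
    exact_mod_cast h4

theorem normSq_coe_pos {x : QuadOrder D} (hx : x ≠ 0) : 0 < Complex.normSq x :=
  Complex.normSq_pos.2 (by simpa using hx)

/-- The two inclusions give integral matrices whose determinants have product 1. Positivity of both
leading coefficients excludes -1, so the equivalence is proper; comparing norms of points then
matches the forms. -/
theorem equivalent_of_span_mul_eq (hD : D < 0) (hF : F.IsPrimPosDef D) (hG : G.IsPrimPosDef D)
    {x y : QuadOrder D} (hx : x ≠ 0) (hy : y ≠ 0)
    (h : Ideal.span {x} * F.toIdeal D = Ideal.span {y} * G.toIdeal D) : F.Equivalent G := by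
  obtain ⟨p, q, r, s, hm, hdet⟩ :=
    exists_matrix_of_span_mul_le hD hF.disc_eq hG.disc_eq h.le
  obtain ⟨p', q', r', s', -, hdet'⟩ :=
    exists_matrix_of_span_mul_le hD hG.disc_eq hF.disc_eq h.ge
  have hFa : (0 : ℝ) < F.a := by exact_mod_cast hF.pos
  have hGa : (0 : ℝ) < G.a := by exact_mod_cast hG.pos
  have hKF : 0 < F.a * Complex.normSq x := mul_pos hFa (normSq_coe_pos hx)
  have hKG : 0 < G.a * Complex.normSq y := mul_pos hGa (normSq_coe_pos hy)
  set m : ℤ := p * s - q * r with hm_def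
  set m' : ℤ := p' * s' - q' * r'
  have hmpos : 0 < m := by
    have : (0 : ℝ) < m := pos_of_mul_pos_left (by rw [hdet]; exact hKF) hKG.le
    exact_mod_cast this
  have hmm : m * m' = 1 := by
    have : ((m : ℝ) * m') * (F.a * Complex.normSq x) = 1 * (F.a * Complex.normSq x) := by
      rw [mul_assoc, hdet', hdet, one_mul]
    have := mul_right_cancel₀ hKF.ne' this
    exact_mod_cast this
  have hm1 : m = 1 := by
    rcases Int.eq_one_or_neg_one_of_mul_eq_one hmm with h | h
    · exact h
    · omega
  rw [hm1, Int.cast_one, one_mul] at hdet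
  refine ⟨⟨!![p, q; r, s], by rw [Matrix.det_fin_two_of]; exact hm1⟩, fun X Y => ?_⟩
  have h1 := congrArg Complex.normSq (hm X Y)
  rw [Complex.normSq_mul, Complex.normSq_mul, normSq_point hD hF.disc_eq,
    normSq_point hD hG.disc_eq] at h1
  have h2 : F.a * Complex.normSq x * (F.eval X Y : ℝ) =
      F.a * Complex.normSq x * (G.eval (p * X + q * Y) (r * X + s * Y) : ℝ) := by
    linear_combination h1 + (G.eval (p * X + q * Y) (r * X + s * Y) : ℝ) * hdet
  have h3 := mul_left_cancel₀ hKF.ne' h2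
  simpa using (by exact_mod_cast h3 :
    F.eval X Y = G.eval (p * X + q * Y) (r * X + s * Y))

/-- Let α be the point of I(G) with coordinates (p, r), the first column of the matrix. Its norm is
G.a·F.a, and α·I(F) = F.a·I(G). -/
theorem Equivalent.exists_span_mul_eq (hD : D < 0) (hF : F.IsPrimPosDef D)
    (hG : G.IsPrimPosDef D) (h : F.Equivalent G) :
    ∃ x y : QuadOrder D, x ≠ 0 ∧ y ≠ 0 ∧
      Ideal.span {x} * F.toIdeal D = Ideal.span {y} * G.toIdeal D := by
  obtain ⟨g, hg⟩ := h
  have hdet := Matrix.det_fin_two g.1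
  rw [g.2] at hdet
  set p : ℤ := g 0 0
  set q : ℤ := g 0 1
  set r : ℤ := g 1 0
  set s : ℤ := g 1 1
  replace hdet : p * s - q * r = 1 := hdet.symm
  have h10 := hg 1 0
  have h01 := hg 0 1
  have h11 := hg 1 1
  simp only [eval, mul_one, mul_zero, add_zero, zero_add, one_pow, ne_eq, OfNat.ofNat_ne_zero,
    not_false_eq_true, zero_pow] at h10 h01 h11
  -- The middle coefficient is F(1, 1) - F(1, 0) - F(0, 1).
  have hb : F.b = 2 * G.a * p * q + G.b * (p * s + q * r) + 2 * G.c * r * s := by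
    linear_combination h11 - h10 - h01
  have hA : (F.a : ℂ) = G.eval p r := by
    rw [eval]; exact_mod_cast h10
  have hbC : (F.b : ℂ) = 2 * G.a * p * q + G.b * (p * s + q * r) + 2 * G.c * r * s := by
    exact_mod_cast hb
  have hdC : (p * s - q * r : ℂ) = 1 := by exact_mod_cast hdet
  have hGa : (G.a : ℂ) ≠ 0 := by exact_mod_cast hG.pos.ne'
  have hFa : (F.a : ℂ) ≠ 0 := by exact_mod_cast hF.pos.ne'
  have hαα := point_mul_conj hD hG.disc_eq (p, r)
  have hroot := root_sq hD hG.disc_eq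
  have hβα : G.point D (q, s) * conj (G.point D (p, r)) = G.a * F.root D := by
    have hF2 : F.root D = G.a * p * q + G.c * r * s + G.b * q * r + G.root D := by
      simp only [root, hbC]
      linear_combination (G.b / 2 : ℂ) * hdC
    simp only [point, map_add, map_mul, map_intCast, conj_root]
    rw [hF2]
    linear_combination (-(r * s) : ℂ) * hroot + (G.a * G.root D : ℂ) * hdC
  have hα0 : G.point D (p, r) ≠ 0 := fun h0 => by
    rw [h0, zero_mul, ← hA] at hαα
    exact mul_ne_zero hGa hFa hαα.symm
  have hkey : G.point D (p, r) * F.root D = F.a * G.point D (q, s) := by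
    apply mul_left_cancel₀ hGa
    rw [← hA] at hαα
    linear_combination G.point D (q, s) * hαα - G.point D (p, r) * hβα
  have hall : ∀ X Y : ℤ, G.point D (p, r) * F.point D (X, Y) =
      F.a * G.point D (p * X + q * Y, r * X + s * Y) := by
    intro X Y
    simp only [point] at hkey ⊢
    push_cast
    linear_combination (Y : ℂ) * hkey
  refine ⟨elem hG.disc_eq (p, r), (F.a : QuadOrder D), fun h0 => hα0 (congrArg Subtype.val h0),
    fun h0 => hFa (by simpa using congrArg Subtype.val h0), le_antisymm ?_ ?_⟩
  · rw [Ideal.span_singleton_mul_le_span_singleton_mul]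
    intro z hz
    obtain ⟨⟨X, Y⟩, hXY⟩ := (mem_toIdeal_iff hD hF.disc_eq).1 hz
    refine ⟨elem hG.disc_eq (p * X + q * Y, r * X + s * Y), elem_mem hD _ _, Subtype.ext ?_⟩
    rw [MulMemClass.coe_mul, MulMemClass.coe_mul, hXY, coe_elem, coe_elem, hall]
    simp
  · rw [Ideal.span_singleton_mul_le_span_singleton_mul]
    intro z hz
    obtain ⟨⟨X, Y⟩, hXY⟩ := (mem_toIdeal_iff hD hG.disc_eq).1 hz
    refine ⟨elem hF.disc_eq (s * X - q * Y, -r * X + p * Y), elem_mem hD _ _, Subtype.ext ?_⟩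
    rw [MulMemClass.coe_mul, MulMemClass.coe_mul, hXY, coe_elem, coe_elem, hall]
    have e1 : p * (s * X - q * Y) + q * (-r * X + p * Y) = X := by
      linear_combination X * hdet
    have e2 : r * (s * X - q * Y) + s * (-r * X + p * Y) = Y := by
      linear_combination Y * hdet
    rw [e1, e2]
    simp

/-- If g divides a, b and c, then ρ/g maps the ideal into itself. An invertible ideal has only 𝒪 as
multipliers, so ρ/g lies in 𝒪, and the coefficient of ρ forces g to be a unit. -/
theorem gcd_eq_one_of_toIdeal_mul_eq (hD : D < 0) (hF : F.disc = D) {x : QuadOrder D}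
    (hx : x ≠ 0) {J : Ideal (QuadOrder D)} (h : F.toIdeal D * J = Ideal.span {x}) :
    Int.gcd (Int.gcd F.a F.b) F.c = 1 := by
  set g : ℤ := (Int.gcd (Int.gcd F.a F.b) F.c : ℤ) with hg
  have hgab : g ∣ (Int.gcd F.a F.b : ℤ) := Int.gcd_dvd_left _ _
  obtain ⟨a', ha⟩ : g ∣ F.a := hgab.trans (Int.gcd_dvd_left _ _)
  obtain ⟨b', hb⟩ : g ∣ F.b := hgab.trans (Int.gcd_dvd_right _ _)
  obtain ⟨c', hc⟩ : g ∣ F.c := Int.gcd_dvd_right _ _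
  have haC : (F.a : ℂ) = g * a' := by exact_mod_cast ha
  have hbC : (F.b : ℂ) = g * b' := by exact_mod_cast hb
  have hcC : (F.c : ℂ) = g * c' := by exact_mod_cast hc
  set ρ : QuadOrder D := ⟨F.root D, root_mem hF⟩ with hρ
  have hle : Ideal.span {ρ} * F.toIdeal D ≤ Ideal.span {(g : QuadOrder D)} * F.toIdeal D := by
    rw [Ideal.span_singleton_mul_le_span_singleton_mul]
    intro z hz
    obtain ⟨⟨X, Y⟩, hXY⟩ := (mem_toIdeal_iff hD hF).1 hz
    refine ⟨elem hF (-Y * c', a' * X + b' * Y), elem_mem hD _ _, Subtype.ext ?_⟩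
    rw [MulMemClass.coe_mul, MulMemClass.coe_mul, hXY, coe_elem, hρ]
    have hr := root_sq hD hF
    simp only [point]
    push_cast
    linear_combination (Y : ℂ) * hr + (X * F.root D : ℂ) * haC + (Y * F.root D : ℂ) * hbC
      - (Y * F.a : ℂ) * hcC
  have hle2 : Ideal.span {ρ * x} ≤ Ideal.span {(g : QuadOrder D) * x} := by
    rw [← Ideal.span_singleton_mul_span_singleton, ← Ideal.span_singleton_mul_span_singleton, ← h,
      ← mul_assoc, ← mul_assoc]
    exact Ideal.mul_mono_left hle
  obtain ⟨t, ht⟩ := Ideal.span_singleton_le_span_singleton.1 hle2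
  have ht' : ρ = g * t := mul_right_cancel₀ hx (by rw [ht]; ring)
  obtain ⟨u, v, huv⟩ := (mem_quadOrder_iff hD hF).1 t.2
  have h1 : ((0 : ℝ) : ℂ) + ((1 : ℝ) : ℂ) * F.root D =
      ((g * u : ℝ) : ℂ) + ((g * v : ℝ) : ℂ) * F.root D := by
    have := congrArg Subtype.val ht'
    rw [MulMemClass.coe_mul, huv, hρ] at this
    push_cast at this ⊢
    linear_combination this
  have h2 := (eq_of_add_mul_root_eq hD h1).2
  have h3 : g * v = 1 := by exact_mod_cast h2.symm
  have h4 := Int.isUnit_iff_natAbs_eq.1 (IsUnit.of_mul_eq_one v h3)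
  rwa [hg, Int.natAbs_natCast] at h4

/-- Every invertible ideal is an integral multiple of the ideal of a primitive form. -/
theorem exists_eq_span_mul_toIdeal (hD : D < 0) (hG : G.disc = D) {x : QuadOrder D}
    (hx : x ≠ 0) {I J : Ideal (QuadOrder D)} (h : I * J = Ideal.span {x}) :
    ∃ F : BinForm, F.IsPrimPosDef D ∧ ∃ e : ℤ, e ≠ 0 ∧
      I = Ideal.span {(e : QuadOrder D)} * F.toIdeal D := by
  set β := basisEquiv hD hG with hβ
  have hβc : ∀ p, (β p : ℂ) = p.1 + p.2 * G.root D := coe_basisEquiv hD hG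
  have hroot := root_sq hD hG
  set M : AddSubgroup (ℤ × ℤ) := I.toAddSubgroup.comap β.toAddMonoidHom with hM
  have hMmem : ∀ p, p ∈ M ↔ β p ∈ I := fun p => Iff.rfl
  have hcyc : ∀ H : AddSubgroup ℤ, ∃ n : ℤ, ∀ y, y ∈ H ↔ n ∣ y := fun H => by
    obtain ⟨n, hn⟩ := Int.subgroup_cyclic H
    refine ⟨n, fun y => ?_⟩
    rw [hn, AddSubgroup.mem_closure_singleton]
    simp only [smul_eq_mul, dvd_iff_exists_eq_mul_left, eq_comm]
  -- Hermite normal form: e generates the ρ-coordinates of I and m generates I ∩ ℤ. Stability under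
  -- ρ makes e divide m and the first coordinate s of a vector (s, e) of I, so e can be factored
  -- out.
  obtain ⟨e, he⟩ := hcyc (M.map (AddMonoidHom.snd ℤ ℤ))
  obtain ⟨m, hm⟩ := hcyc (M.comap (AddMonoidHom.inl ℤ ℤ))
  replace hm : ∀ y, (y, 0) ∈ M ↔ m ∣ y := hm
  have he' : ∀ p ∈ M, e ∣ p.2 := fun p hp => (he p.2).1 ⟨p, hp, rfl⟩
  have hmul : ∀ p ∈ M, (-(p.2 * G.a * G.c), p.1 + p.2 * G.b) ∈ M := fun p hp => by
    have h1 := I.mul_mem_left ⟨G.root D, root_mem hG⟩ ((hMmem p).1 hp)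
    rw [hMmem]
    convert h1 using 1
    refine Subtype.ext ?_
    rw [MulMemClass.coe_mul, hβc, hβc]
    push_cast
    linear_combination (-p.2 : ℂ) * hroot
  obtain ⟨⟨s, e0⟩, hs, rfl⟩ : e ∈ M.map (AddMonoidHom.snd ℤ ℤ) := (he e).2 dvd_rfl
  change ∀ p ∈ M, e0 ∣ p.2 at he'
  obtain ⟨A, rfl⟩ : e0 ∣ m := by
    have := he' _ (hmul _ ((hm m).2 dvd_rfl))
    simpa using this
  obtain ⟨s', rfl⟩ : e0 ∣ s := by
    have := he' _ (hmul _ hs)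
    exact (Int.dvd_add_left (dvd_mul_right e0 G.b)).1 this
  have he0 : e0 ≠ 0 := by
    rintro rfl
    have hbot : I = ⊥ := by
      rw [eq_bot_iff]
      intro z hz
      obtain ⟨p, rfl⟩ := β.surjective z
      have h2 : p.2 = 0 := zero_dvd_iff.1 (he' p hz)
      have hp : (p.1, 0) ∈ M := by rw [← h2]; exact hz
      have h1 : p.1 = 0 := by simpa using (hm _).1 hp
      have : p = 0 := Prod.ext h1 h2
      rw [this, map_zero]
      exact Ideal.zero_mem _
    rw [hbot, Ideal.bot_mul, eq_comm, Ideal.span_singleton_eq_bot] at h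
    exact hx h
  obtain ⟨C, hC⟩ : A ∣ s' ^ 2 + s' * G.b + G.a * G.c := by
    have h1 := M.sub_mem (M.zsmul_mem hs (s' + G.b)) (hmul _ hs)
    have h2 : (e0 * (s' ^ 2 + s' * G.b + G.a * G.c), 0) ∈ M := by
      convert h1 using 1
      ext <;> simp <;> ring
    exact Int.dvd_of_mul_dvd_mul_left he0 ((hm _).1 h2)
  have hpos : 0 < s' ^ 2 + s' * G.b + G.a * G.c := by
    have := hG
    unfold disc at this
    nlinarith [sq_nonneg (2 * s' + G.b)]
  have hA0 : A ≠ 0 := by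
    rintro rfl
    rw [zero_mul] at hC
    exact hpos.ne' hC
  -- The generator e0·A of I ∩ ℤ is known only up to sign; moving the sign of A to C makes the
  -- leading coefficient positive and keeps the product.
  set F : BinForm := ⟨|A|, G.b + 2 * s', A.sign * C⟩ with hF
  have hac : |A| * (A.sign * C) = s' ^ 2 + s' * G.b + G.a * G.c := by
    rw [hC, ← mul_assoc, mul_comm |A|, Int.sign_mul_abs]
  have hFd : F.disc = D := by
    rw [← hG, disc, disc, hF]
    linear_combination -4 * hac
  have hFr : F.root D = G.root D + s' := by
    simp only [root, hF]
    push_cast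
    ring
  have hI : I = Ideal.span {(e0 : QuadOrder D)} * F.toIdeal D := by
    ext z
    rw [Ideal.mem_span_singleton_mul]
    constructor
    · intro hz
      obtain ⟨⟨u, v⟩, rfl⟩ := β.surjective z
      obtain ⟨Y, hY⟩ := he' _ hz
      dsimp only at hY
      subst hY
      have h1 : (u - Y * (e0 * s'), 0) ∈ M := by
        convert M.sub_mem ((hMmem _).2 hz) (M.zsmul_mem hs Y) using 1
        ext <;> simp; ring
      obtain ⟨X, hX⟩ := (hm _).1 h1
      refine ⟨elem hFd (A.sign * X, Y), elem_mem hD _ _, Subtype.ext ?_⟩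
      rw [MulMemClass.coe_mul, coe_elem, hβc]
      simp only [point, hFr]
      have h2 : F.a * (A.sign * X) = A * X := by
        rw [hF, ← mul_assoc, mul_comm |A|, Int.sign_mul_abs]
      have h3 : (F.a : ℂ) * (A.sign * X : ℤ) = A * X := by exact_mod_cast h2
      have h4 : (u : ℂ) - Y * (e0 * s') = e0 * A * X := by exact_mod_cast hX
      rw [h3]
      push_cast
      linear_combination -h4
    · rintro ⟨w, hw, rfl⟩
      obtain ⟨⟨X, Y⟩, hXY⟩ := (mem_toIdeal_iff hD hFd).1 hw
      have h1 : (e0 * A * (A.sign * X), 0) ∈ M := (hm _).2 (dvd_mul_right _ _)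
      have h2 := (hMmem _).1 (M.add_mem h1 (M.zsmul_mem hs Y))
      convert h2 using 1
      refine Subtype.ext ?_
      rw [MulMemClass.coe_mul, hXY, hβc]
      have h3 : (F.a : ℂ) = A * A.sign := by
        rw [mul_comm]
        exact_mod_cast (Int.sign_mul_self_eq_abs A).symm
      simp only [point, hFr, h3, Prod.fst_add, Prod.snd_add, Prod.smul_fst, Prod.smul_snd]
      push_cast [smul_eq_mul]
      ring
  refine ⟨F, ⟨hFd, ?_, abs_pos.2 hA0⟩, e0, he0, hI⟩
  refine gcd_eq_one_of_toIdeal_mul_eq hD hFd hx (J := Ideal.span {(e0 : QuadOrder D)} * J) ?_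
  rw [← h, hI]
  ring

theorem coe_toInvIdeal (hD : D < 0) (hF : F.IsPrimPosDef D) :
    (F.toInvIdeal D : FractionalIdeal (QuadOrder D)⁰ (FractionRing (QuadOrder D))) =
      (F.toIdeal D : Ideal (QuadOrder D)) := by
  rw [toInvIdeal, dif_pos (isUnit_toIdeal hD hF)]
  rfl

theorem toClass_eq_iff (hD : D < 0) (hF : F.IsPrimPosDef D) (hG : G.IsPrimPosDef D) :
    F.toClass D = G.toClass D ↔ F.Equivalent G := by
  rw [toClass, toClass, ClassGroup.mk_eq_mk_of_coe_ideal (coe_toInvIdeal hD hF)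
    (coe_toInvIdeal hD hG)]
  exact ⟨fun ⟨x, y, hx, hy, h⟩ => equivalent_of_span_mul_eq hD hF hG hx hy h,
    fun h => h.exists_span_mul_eq hD hF hG⟩

/-- Clearing denominators in both u and u⁻¹ gives integral ideals with principal product IJ = (xy),
the situation of `exists_eq_span_mul_toIdeal`. -/
theorem exists_toClass_eq (hD : D < 0) (hG : G.disc = D) (κ : QuadClassGroup D) :
    ∃ F : BinForm, F.IsPrimPosDef D ∧ F.toClass D = κ := by
  refine ClassGroup.induction (FractionRing (QuadOrder D)) (fun u => ?_) κ
  obtain ⟨x, I, hx, hI⟩ := FractionalIdeal.exists_eq_spanSingleton_mul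
    (u : FractionalIdeal (QuadOrder D)⁰ (FractionRing (QuadOrder D)))
  obtain ⟨y, J, hy, hJ⟩ := FractionalIdeal.exists_eq_spanSingleton_mul
    ((u⁻¹ : InvIdeals D) : FractionalIdeal (QuadOrder D)⁰ (FractionRing (QuadOrder D)))
  have hx' : algebraMap (QuadOrder D) (FractionRing (QuadOrder D)) x ≠ 0 := by simpa using hx
  have hy' : algebraMap (QuadOrder D) (FractionRing (QuadOrder D)) y ≠ 0 := by simpa using hy
  have hcancel : ∀ z : FractionRing (QuadOrder D), z ≠ 0 →
      FractionalIdeal.spanSingleton (QuadOrder D)⁰ z *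
        FractionalIdeal.spanSingleton (QuadOrder D)⁰ z⁻¹ = 1 := fun z hz => by
    rw [FractionalIdeal.spanSingleton_mul_spanSingleton, mul_inv_cancel₀ hz,
      FractionalIdeal.spanSingleton_one]
  have hmon : ∀ {X X' Y Y' U V :
      FractionalIdeal (QuadOrder D)⁰ (FractionRing (QuadOrder D))},
      X * X' = 1 → Y * Y' = 1 → X' * U * (Y' * V) = 1 → U * V = X * Y :=
      fun {X X' Y Y' U V} hX hY hUV => by
    calc U * V = (X * X') * (Y * Y') * (U * V) := by rw [hX, hY, one_mul, one_mul]
      _ = X * Y * (X' * U * (Y' * V)) := by ring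
      _ = X * Y := by rw [hUV, mul_one]
  have hIJ : I * J = Ideal.span {x * y} := by
    apply FractionalIdeal.coeIdeal_injective (K := FractionRing (QuadOrder D))
    have h1 := u.mul_inv
    rw [hI, hJ] at h1
    change ((I * J : Ideal (QuadOrder D)) : FractionalIdeal (QuadOrder D)⁰ _) =
      ((Ideal.span {x * y} : Ideal (QuadOrder D)) : FractionalIdeal (QuadOrder D)⁰ _)
    rw [FractionalIdeal.coeIdeal_mul, FractionalIdeal.coeIdeal_span_singleton, map_mul,
      ← FractionalIdeal.spanSingleton_mul_spanSingleton]
    exact hmon (hcancel _ hx') (hcancel _ hy') h1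
  obtain ⟨F, hF, e, he, hIF⟩ := exists_eq_span_mul_toIdeal hD hG (mul_ne_zero hx hy) hIJ
  have he' : algebraMap (QuadOrder D) (FractionRing (QuadOrder D)) e ≠ 0 := by
    have h0 : (e : QuadOrder D) ≠ 0 := fun h0 => he (by
      have := congrArg Subtype.val h0
      exact_mod_cast this)
    simpa using h0
  refine ⟨F, hF, ?_⟩
  rw [toClass, ClassGroup.mk_eq_mk]
  refine ⟨(Units.mk0 _ hx')⁻¹ * Units.mk0 _ he', Units.ext ?_⟩
  rw [Units.val_mul, coe_toPrincipalIdeal, coe_toInvIdeal hD hF, hI, hIF,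
    FractionalIdeal.coeIdeal_mul, FractionalIdeal.coeIdeal_span_singleton, Units.val_mul,
    Units.val_inv_eq_inv_val, Units.val_mk0, Units.val_mk0,
    ← FractionalIdeal.spanSingleton_mul_spanSingleton]
  ring

/-! ### Definiteness and finiteness of representations -/

theorem four_mul_a_mul_eval (hF : F.disc = D) (x y : ℤ) :
    4 * F.a * F.eval x y = (2 * F.a * x + F.b * y) ^ 2 - D * y ^ 2 := by
  rw [← hF, disc, eval]; ring

theorem four_mul_c_mul_eval (hF : F.disc = D) (x y : ℤ) :
    4 * F.c * F.eval x y = (2 * F.c * y + F.b * x) ^ 2 - D * x ^ 2 := by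
  rw [← hF, disc, eval]; ring

theorem sq_snd_le (hD : D < 0) (hF : F.disc = D) (x y : ℤ) :
    y ^ 2 ≤ 4 * F.a * F.eval x y := by
  rw [four_mul_a_mul_eval hF]
  nlinarith [sq_nonneg (2 * F.a * x + F.b * y), sq_nonneg y]

theorem sq_fst_le (hD : D < 0) (hF : F.disc = D) (x y : ℤ) :
    x ^ 2 ≤ 4 * F.c * F.eval x y := by
  rw [four_mul_c_mul_eval hF]
  nlinarith [sq_nonneg (2 * F.c * y + F.b * x), sq_nonneg x]

theorem finite_eval_eq (hD : D < 0) (hF : F.disc = D) (N : ℤ) :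
    {p : ℤ × ℤ | F.eval p.1 p.2 = N}.Finite := by
  have habs : ∀ z : ℤ, |z| ≤ z ^ 2 := fun z => by
    rw [← sq_abs]
    nlinarith [abs_nonneg z, Int.le_self_sq |z|]
  refine (Set.Finite.prod (Set.finite_Icc (-(4 * F.c * N)) (4 * F.c * N))
    (Set.finite_Icc (-(4 * F.a * N)) (4 * F.a * N))).subset ?_
  rintro ⟨x, y⟩ (h : F.eval x y = N)
  have h1 := sq_fst_le hD hF x y
  have h2 := sq_snd_le hD hF x y
  rw [h] at h1 h2
  exact ⟨Set.mem_Icc.2 (abs_le.1 ((habs x).trans h1)),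
    Set.mem_Icc.2 (abs_le.1 ((habs y).trans h2))⟩

theorem eval_pos (hD : D < 0) (hF : F.IsPrimPosDef D) {p : ℤ × ℤ} (hp : p ≠ 0) :
    0 < F.eval p.1 p.2 := by
  have h1 := sq_fst_le hD hF.disc_eq p.1 p.2
  have h2 := sq_snd_le hD hF.disc_eq p.1 p.2
  have ha := hF.pos
  have hc := hF.c_pos hD
  by_contra! h
  have h3 : p.1 ^ 2 ≤ 0 := h1.trans (by nlinarith)
  have h4 : p.2 ^ 2 ≤ 0 := h2.trans (by nlinarith)
  exact hp (Prod.ext (pow_eq_zero_iff two_ne_zero |>.1 (le_antisymm h3 (sq_nonneg _)))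
    (pow_eq_zero_iff two_ne_zero |>.1 (le_antisymm h4 (sq_nonneg _))))

/-! ### Integral ideals as lattice points modulo units -/

theorem elem_ne_zero (hD : D < 0) (hF : F.IsPrimPosDef D) {p : ℤ × ℤ} (hp : p ≠ 0) :
    elem hF.disc_eq p ≠ 0 := fun h => hp (point_injective hD hF.pos (by
  rw [← coe_elem hF.disc_eq p, h]
  simp [point]))

/-- If the product of an ideal with the ideal of a primitive form `F` is generated by the lattice
point with coordinates `p`, then its norm is `F(p)`. -/
theorem card_quotient_of_mul_toIdeal_eq (hD : D < 0) (hF : F.IsPrimPosDef D) {p : ℤ × ℤ}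
    (hp : p ≠ 0) {I : Ideal (QuadOrder D)}
    (h : I * F.toIdeal D = Ideal.span {elem hF.disc_eq p}) :
    (Nat.card (QuadOrder D ⧸ I) : ℤ) = F.eval p.1 p.2 := by
  have hpos := eval_pos hD hF hp
  have ha : (F.a : QuadOrder D) ≠ 0 := fun h0 => hF.pos.ne' (by
    have := congrArg Subtype.val h0
    exact_mod_cast this)
  obtain ⟨A, hA⟩ := Int.eq_ofNat_of_zero_le hF.pos.le
  obtain ⟨N, hN⟩ := Int.eq_ofNat_of_zero_le hpos.le
  -- Multiplying by the opposite ideal gives a·I = α·I(F.opp); taking norms, a²·N(I) = a·F(p)·a.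
  have h1 : Ideal.span {(F.a : QuadOrder D)} * I =
      Ideal.span {elem hF.disc_eq p} * F.opp.toIdeal D := by
    rw [← toIdeal_mul_toIdeal_opp hD hF, ← h]
    ring
  have h2 := congrArg (fun J : Ideal (QuadOrder D) => Nat.card (QuadOrder D ⧸ J)) h1
  have h3 : Complex.normSq (elem hF.disc_eq p : ℂ) = (A * N : ℕ) := by
    rw [coe_elem, normSq_point hD hF.disc_eq, hA, hN]
    push_cast
    rfl
  beta_reduce at h2
  rw [Ideal.card_quotient_span_singleton_mul ha,
    Ideal.card_quotient_span_singleton_mul (elem_ne_zero hD hF hp),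
    card_quotient_span_intCast hD hF.disc_eq, card_quotient_toIdeal hD hF.opp.disc_eq,
    card_quotient_span_singleton hD hF.disc_eq (elem_ne_zero hD hF hp) h3] at h2
  change F.a.natAbs ^ 2 * _ = A * N * F.a.natAbs at h2
  have hA0 : 0 < A := by
    have := hF.pos
    omega
  rw [hA, Int.natAbs_natCast] at h2
  have h4 : Nat.card (QuadOrder D ⧸ I) = N := by
    apply Nat.eq_of_mul_eq_mul_left (pow_pos hA0 2)
    rw [h2]
    ring
  rw [h4, hN]

/-- The relation `u · I(F) = α 𝒪` for the lattice point `α` of `F` with coordinates `p`. -/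
def Divides (u : InvIdeals D) (hF : F.disc = D) (p : ℤ × ℤ) : Prop :=
  (u : FractionalIdeal (QuadOrder D)⁰ (FractionRing (QuadOrder D))) * (F.toIdeal D :) =
    (Ideal.span {elem hF p} : Ideal (QuadOrder D))

theorem exists_divides (hD : D < 0) (hF : F.IsPrimPosDef D) {p : ℤ × ℤ} (hp : p ≠ 0) :
    ∃ u : InvIdeals D, Divides u hF.disc_eq p := by
  have h0 : algebraMap (QuadOrder D) (FractionRing (QuadOrder D)) (elem hF.disc_eq p) ≠ 0 := by
    simpa using elem_ne_zero hD hF hp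
  refine ⟨toPrincipalIdeal (QuadOrder D) (FractionRing (QuadOrder D)) (Units.mk0 _ h0) *
    (F.toInvIdeal D)⁻¹, ?_⟩
  rw [Divides, ← coe_toInvIdeal hD hF, ← Units.val_mul, inv_mul_cancel_right, coe_toPrincipalIdeal,
    Units.val_mk0, FractionalIdeal.coeIdeal_span_singleton]

/-- Here u = α·I(F)⁻¹ with α in I(F), so u is automatically integral, and its norm is F(p). -/
theorem Divides.mem_integralOfNorm_iff (hD : D < 0) (hF : F.IsPrimPosDef D) {p : ℤ × ℤ}
    (hp : p ≠ 0) {u : InvIdeals D} (h : Divides u hF.disc_eq p) (N : ℕ) :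
    u ∈ integralOfNorm D N ↔ F.eval p.1 p.2 = N := by
  have hle : (u : FractionalIdeal (QuadOrder D)⁰ (FractionRing (QuadOrder D))) ≤ 1 := by
    have h1 : (u : FractionalIdeal (QuadOrder D)⁰ (FractionRing (QuadOrder D))) =
        (Ideal.span {elem hF.disc_eq p} : Ideal (QuadOrder D)) *
          ((F.toInvIdeal D)⁻¹ : InvIdeals D) := by
      rw [← h, ← coe_toInvIdeal hD hF, Units.mul_inv_cancel_right]
    rw [h1, ← Units.mul_inv (F.toInvIdeal D), coe_toInvIdeal hD hF]
    gcongr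
    rw [Ideal.span_singleton_le_iff_mem]
    exact elem_mem hD hF.disc_eq p
  obtain ⟨I, hI⟩ := FractionalIdeal.le_one_iff_exists_coeIdeal.1 hle
  have hIF : I * F.toIdeal D = Ideal.span {elem hF.disc_eq p} := by
    apply FractionalIdeal.coeIdeal_injective (K := FractionRing (QuadOrder D))
    change ((I * F.toIdeal D : Ideal (QuadOrder D)) : FractionalIdeal (QuadOrder D)⁰ _) = _
    rw [FractionalIdeal.coeIdeal_mul, hI]
    exact h
  rw [← card_quotient_of_mul_toIdeal_eq hD hF hp hIF, Nat.cast_inj]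
  constructor
  · rintro ⟨J, hJ, hN⟩
    rwa [show I = J from FractionalIdeal.coeIdeal_injective (K := FractionRing (QuadOrder D))
      (hI.trans hJ)]
  · exact fun hN => ⟨I, hI.symm, hN⟩

theorem Divides.mk_mul_toClass (hD : D < 0) (hF : F.IsPrimPosDef D) {p : ℤ × ℤ}
    (hp : p ≠ 0) {u : InvIdeals D} (h : Divides u hF.disc_eq p) :
    ClassGroup.mk (FractionRing (QuadOrder D)) u * F.toClass D = 1 := by
  rw [toClass, ← map_mul]
  refine (ClassGroup.mk_eq_one_of_coe_ideal (I' := Ideal.span {elem hF.disc_eq p}) ?_).2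
    ⟨_, elem_ne_zero hD hF hp, rfl⟩
  rw [Units.val_mul, coe_toInvIdeal hD hF]
  exact h

theorem Divides.heckeChar_mul (hD : D < 0) (hF : F.IsPrimPosDef D) {p : ℤ × ℤ}
    {u : InvIdeals D} (h : Divides u hF.disc_eq p) {ℓ : ℕ} (Ψ : OrderHeckeChar D ℓ) :
    (Ψ.toHom u : ℂ) * Ψ.toHom (F.toInvIdeal D) = F.point D p ^ ℓ := by
  rw [← Units.val_mul, ← map_mul]
  refine Ψ.map_principal (elem hF.disc_eq p) _ ?_
  rw [Units.val_mul, coe_toInvIdeal hD hF]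
  exact h

theorem Divides.exists_unit (hF : F.disc = D) {p q : ℤ × ℤ} {u : InvIdeals D}
    (h : Divides u hF p) (h' : Divides u hF q) :
    ∃ ε : (QuadOrder D)ˣ, elem hF p * ε = elem hF q :=
  Ideal.span_singleton_eq_span_singleton.1
    (FractionalIdeal.coeIdeal_injective (K := FractionRing (QuadOrder D)) (h.symm.trans h'))

theorem exists_divides_of_mk_mul_toClass_eq_one (hD : D < 0) (hF : F.IsPrimPosDef D) {u : InvIdeals D} {N : ℕ}
    (hu : u ∈ integralOfNorm D N)
    (h : ClassGroup.mk (FractionRing (QuadOrder D)) u * F.toClass D = 1) :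
    ∃ p : ℤ × ℤ, p ≠ 0 ∧ Divides u hF.disc_eq p := by
  obtain ⟨I, hI, -⟩ := hu
  rw [toClass, ← map_mul] at h
  have hIF : ((u * F.toInvIdeal D : InvIdeals D) :
      FractionalIdeal (QuadOrder D)⁰ (FractionRing (QuadOrder D))) =
        (I * F.toIdeal D : Ideal (QuadOrder D)) := by
    rw [Units.val_mul, coe_toInvIdeal hD hF, hI, FractionalIdeal.coeIdeal_mul]
  obtain ⟨x, hx, hIx⟩ := (ClassGroup.mk_eq_one_of_coe_ideal hIF).1 h
  have hxF : x ∈ F.toIdeal D := by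
    have h1 : x ∈ I * F.toIdeal D := by
      rw [hIx]
      exact Ideal.mem_span_singleton_self x
    exact Ideal.mul_le_right h1
  obtain ⟨p, hp⟩ := (mem_toIdeal_iff hD hF.disc_eq).1 hxF
  have hpx : elem hF.disc_eq p = x := Subtype.ext hp.symm
  refine ⟨p, ?_, ?_⟩
  · rintro rfl
    apply hx
    rw [← hpx]
    exact Subtype.ext (by simp [coe_elem, point])
  · rw [Divides, hpx, ← hIx, FractionalIdeal.coeIdeal_mul, hI]

open Classical in
/-- The coefficients of the form of a Hecke character in terms of representatives of the form
classes. -/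
theorem card_units_mul_heckeForm (hD : D < 0) (hG : G.disc = D) {ι : Type*} [Fintype ι]
    {R : ι → BinForm} (hR : ∀ i, (R i).IsPrimPosDef D)
    (hrep : ∀ F : BinForm, F.IsPrimPosDef D → ∃! i, F.Equivalent (R i))
    {ℓ : ℕ} (Ψ : OrderHeckeChar D ℓ) {N : ℕ} (hN : N ≠ 0) :
    (Nat.card (QuadOrder D)ˣ : ℂ) * heckeForm Ψ N =
      ∑ i, ∑ᶠ p ∈ {p : ℤ × ℤ | (R i).eval p.1 p.2 = N},
        (R i).point D p ^ ℓ * ((Ψ.toHom ((R i).toInvIdeal D) : ℂ))⁻¹ := by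
  set S : Finset (Σ _ : ι, ℤ × ℤ) := Finset.univ.sigma fun i =>
    (finite_eval_eq hD (hR i).disc_eq N).toFinset with hS
  have hmem : ∀ s, s ∈ S ↔ (R s.1).eval s.2.1 s.2.2 = N := fun s => by simp [hS]
  have hne : ∀ s ∈ S, s.2 ≠ 0 := fun s hs h0 => hN (by
    have := (hmem s).1 hs
    rw [h0] at this
    simp only [eval, Prod.fst_zero, Prod.snd_zero] at this
    simpa using this.symm)
  have hex : ∀ s, s ∈ S → ∃ u : InvIdeals D, Divides u (hR s.1).disc_eq s.2 := fun s hs =>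
    exists_divides hD (hR s.1) (hne s hs)
  -- T sends a class index and a lattice point α to the ideal α·I(R i)⁻¹. The identity counts along
  -- the fibres of T.
  choose! T hT using hex
  have hTint : ∀ s ∈ S, T s ∈ integralOfNorm D N := fun s hs =>
    ((hT s hs).mem_integralOfNorm_iff hD (hR s.1) (hne s hs) N).2 ((hmem s).1 hs)
  have hTu : ∀ s ∈ S, ∀ u, Divides u (hR s.1).disc_eq s.2 → T s = u := fun s hs u hu => by
    have h1 := (hT s hs).trans hu.symm
    rw [← coe_toInvIdeal hD (hR s.1)] at h1
    exact Units.ext ((Units.mul_left_inj _).1 h1)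
  have hsurj : ∀ u ∈ integralOfNorm D N, ∃ s ∈ S, T s = u := fun u hu => by
    obtain ⟨F, hF, hFu⟩ := exists_toClass_eq hD hG
      (ClassGroup.mk (FractionRing (QuadOrder D)) u)⁻¹
    obtain ⟨i, hi, -⟩ := hrep F hF
    rw [← toClass_eq_iff hD hF (hR i)] at hi
    obtain ⟨p, hp0, hp⟩ := exists_divides_of_mk_mul_toClass_eq_one hD (hR i) hu (by rw [← hi, hFu, mul_inv_cancel])
    have hs : (⟨i, p⟩ : Σ _ : ι, ℤ × ℤ) ∈ S :=
      (hmem _).2 ((hp.mem_integralOfNorm_iff hD (hR i) hp0 N).1 hu)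
    exact ⟨⟨i, p⟩, hs, hTu _ hs u hp⟩
  have hset : integralOfNorm D N = ↑(S.image T) := by
    ext u
    simp only [Finset.coe_image, Set.mem_image, Finset.mem_coe]
    exact ⟨hsurj u, by rintro ⟨s, hs, rfl⟩; exact hTint s hs⟩
  -- The class of u fixes the index i, and the generators of the principal ideal u·I(R i) form one
  -- orbit of the units, which act freely.
  have hfib : ∀ u ∈ S.image T, (S.filter fun s => T s = u).card = Nat.card (QuadOrder D)ˣ := by
    intro u hu
    obtain ⟨⟨i, p⟩, hs, rfl⟩ := Finset.mem_image.1 hu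
    have hidx : ∀ j q, (⟨j, q⟩ : Σ _ : ι, ℤ × ℤ) ∈ S → T ⟨j, q⟩ = T ⟨i, p⟩ → j = i :=
        fun j q hj hjT => by
      have h1 := (hT _ hs).mk_mul_toClass hD (hR i) (hne _ hs)
      have h2 := (hT _ hj).mk_mul_toClass hD (hR j) (hne _ hj)
      rw [hjT, ← h1] at h2
      exact (hrep (R j) (hR j)).unique ((toClass_eq_iff hD (hR j) (hR j)).1 rfl)
        ((toClass_eq_iff hD (hR j) (hR i)).1 (mul_left_cancel h2))
    have hunit : ∀ s : {s // s ∈ S.filter fun s => T s = T ⟨i, p⟩}, ∃ ε : (QuadOrder D)ˣ,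
        s.1.1 = i ∧ elem (hR i).disc_eq p * ε = elem (hR i).disc_eq s.1.2 := by
      rintro ⟨⟨j, q⟩, hjq⟩
      obtain ⟨hj, hjT⟩ := Finset.mem_filter.1 hjq
      obtain rfl := hidx j q hj hjT
      have h2 := hT _ hj
      rw [hjT] at h2
      obtain ⟨ε, hε⟩ := (hT _ hs).exists_unit _ h2
      exact ⟨ε, rfl, hε⟩
    choose E hE1 hE2 using hunit
    rw [← Fintype.card_coe, ← Nat.card_eq_fintype_card]
    refine Nat.card_eq_of_bijective E ⟨?_, fun ε => ?_⟩
    · rintro ⟨⟨j, q⟩, hj⟩ ⟨⟨j', q'⟩, hj'⟩ hE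
      have e1 : j = i := hE1 ⟨⟨j, q⟩, hj⟩
      have e2 : j' = i := hE1 ⟨⟨j', q'⟩, hj'⟩
      have e3 := hE2 ⟨⟨j, q⟩, hj⟩
      rw [hE, hE2 ⟨⟨j', q'⟩, hj'⟩] at e3
      have e4 : q' = q := point_injective hD (hR i).pos (congrArg Subtype.val e3)
      subst e1 e2 e4
      rfl
    · obtain ⟨q, hq⟩ := (mem_toIdeal_iff hD (hR i).disc_eq).1
        (Ideal.mul_mem_right (ε : QuadOrder D) _ (elem_mem hD (hR i).disc_eq p))
      replace hq : elem (hR i).disc_eq p * ε = elem (hR i).disc_eq q := Subtype.ext hq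
      have hdiv : Divides (T ⟨i, p⟩) (hR i).disc_eq q := by
        have h1 := hT _ hs
        rw [Divides] at h1 ⊢
        rw [h1, ← hq, Ideal.span_singleton_mul_right_unit ε.isUnit]
      have hq0 : q ≠ 0 := by
        rintro rfl
        refine mul_ne_zero (elem_ne_zero hD (hR i) (hne _ hs)) ε.ne_zero ?_
        rw [hq]
        exact Subtype.ext (by simp [coe_elem, point])
      have hqS : (⟨i, q⟩ : Σ _ : ι, ℤ × ℤ) ∈ S :=
        (hmem _).2 ((hdiv.mem_integralOfNorm_iff hD (hR i) hq0 N).1 (hTint _ hs))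
      have hqF : (⟨i, q⟩ : Σ _ : ι, ℤ × ℤ) ∈ S.filter fun s => T s = T ⟨i, p⟩ :=
        Finset.mem_filter.2 ⟨hqS, hTu _ hqS _ hdiv⟩
      refine ⟨⟨⟨i, q⟩, hqF⟩, Units.ext (mul_left_cancel₀
        (elem_ne_zero hD (hR i) (hne _ hs)) ?_)⟩
      rw [hq]
      exact hE2 ⟨⟨i, q⟩, hqF⟩
  rw [heckeForm, hset, finsum_mem_coe_finset, Finset.mul_sum]
  have hR2 : ∑ i, ∑ᶠ p ∈ {p : ℤ × ℤ | (R i).eval p.1 p.2 = N},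
        (R i).point D p ^ ℓ * ((Ψ.toHom ((R i).toInvIdeal D) : ℂ))⁻¹ =
      ∑ s ∈ S, (R s.1).point D s.2 ^ ℓ * ((Ψ.toHom ((R s.1).toInvIdeal D) : ℂ))⁻¹ := by
    rw [hS, Finset.sum_sigma]
    exact Finset.sum_congr rfl fun i _ => finsum_mem_eq_finite_toFinset_sum _ _
  rw [hR2, ← Finset.sum_fiberwise_of_maps_to (g := T) (t := S.image T)
    (fun s hs => Finset.mem_image_of_mem T hs)]
  refine Finset.sum_congr rfl fun u hu => ?_
  rw [← hfib u hu, ← nsmul_eq_mul, ← Finset.sum_const]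
  refine Finset.sum_congr rfl fun s hs => ?_
  obtain ⟨hsS, rfl⟩ := Finset.mem_filter.1 hs
  rw [← (hT s hsS).heckeChar_mul hD (hR s.1) Ψ, mul_assoc, mul_inv_cancel₀ (Units.ne_zero _),
    mul_one]

end BinForm

/-- A unit ε generates the trivial ideal, so ε² = Φ(𝒪) = 1: the existence of Φ excludes orders with
extra units. -/
theorem OrderHeckeChar.card_units_eq_two {D : ℤ} (Φ : OrderHeckeChar D 2) :
    Nat.card (QuadOrder D)ˣ = 2 := by
  refine Nat.card_eq_two_iff.2 ⟨1, -1, fun h => ?_, ?_⟩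
  · have h1 := congrArg (fun u : (QuadOrder D)ˣ => ((u : QuadOrder D) : ℂ)) h
    norm_num at h1
  · refine Set.eq_univ_of_forall fun u => ?_
    have h1 := Φ.map_principal (u : QuadOrder D) 1 (by
      rw [Ideal.span_singleton_eq_top.2 u.isUnit, FractionalIdeal.coeIdeal_top]
      rfl)
    rw [map_one, Units.val_one] at h1
    rcases mul_self_eq_one_iff.1 ((sq _).symm.trans h1.symm) with h2 | h2
    · exact Or.inl (Units.ext (Subtype.ext h2))
    · exact Or.inr (Units.ext (Subtype.ext (by simpa using h2)))

/-! ### The reflection automorph and the weight-three theta series -/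

namespace BinForm

variable {D : ℤ} {F : BinForm}

/-- The reflection `(x, y) ↦ (-x - κ y, y)`, an automorph of a form `[a, κ a, c]`. -/
def reflection (κ : ℤ) : ℤ × ℤ ≃ ℤ × ℤ where
  toFun p := (-p.1 - κ * p.2, p.2)
  invFun p := (-p.1 - κ * p.2, p.2)
  left_inv p := by ext <;> simp
  right_inv p := by ext <;> simp

theorem eval_reflection {κ : ℤ} (hκ : F.b = κ * F.a) (p : ℤ × ℤ) :
    F.eval (reflection κ p).1 (reflection κ p).2 = F.eval p.1 p.2 := by
  simp only [reflection, Equiv.coe_fn_mk, eval, hκ]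
  ring

theorem point_reflection {κ : ℤ} (hκ : F.b = κ * F.a) (p : ℤ × ℤ) :
    F.point D (reflection κ p) = -conj (F.point D p) := by
  have h : (F.b : ℂ) = κ * F.a := by exact_mod_cast hκ
  simp only [reflection, Equiv.coe_fn_mk, point, map_add, map_mul, map_intCast, conj_root]
  rw [h]
  push_cast
  ring

/-- The spherical weight `(a x ^ 2 - c y ^ 2) / 2` of the theta series of weight three. -/
def weight (F : BinForm) (p : ℤ × ℤ) : ℂ :=
  (1 / 2 : ℂ) * ((F.a : ℂ) * (p.1 : ℂ) ^ 2 - (F.c : ℂ) * (p.2 : ℂ) ^ 2)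

/-- The weight has no mixed term xy, unlike α² + ᾱ²; adding its reflected copy supplies it, because
aκ = b. -/
theorem point_sq_add_conj_sq (hD : D < 0) (hF : F.disc = D) {κ : ℤ} (hκ : F.b = κ * F.a)
    (p : ℤ × ℤ) :
    F.point D p ^ 2 + conj (F.point D p) ^ 2 =
      2 * F.a * (F.weight p + F.weight (reflection κ p)) := by
  have h : (F.b : ℂ) = κ * F.a := by exact_mod_cast hκ
  have hr := root_sq hD hF
  simp only [reflection, Equiv.coe_fn_mk, point, map_add, map_mul, map_intCast, conj_root, weight]
  rw [h] at hr ⊢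
  push_cast
  linear_combination (2 * (p.2 : ℂ) ^ 2) * hr

/-- The reflection permutes the solutions of F = N and exchanges α² with ᾱ², so ∑ α² is half of ∑
(α² + ᾱ²), and both halves of the weight contribute equally. -/
theorem finsum_point_sq (hD : D < 0) (hF : F.disc = D) {κ : ℤ} (hκ : F.b = κ * F.a) (N : ℕ) :
    ∑ᶠ p ∈ {p : ℤ × ℤ | F.eval p.1 p.2 = N}, F.point D p ^ 2 = 2 * F.a * thetaThree F N := by
  have hfin := finite_eval_eq hD hF N
  set S := hfin.toFinset with hS
  have hmem : ∀ p, p ∈ S ↔ reflection κ p ∈ S := fun p => by simp [hS, eval_reflection hκ]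
  have hsum : ∀ f : ℤ × ℤ → ℂ, ∑ p ∈ S, f (reflection κ p) = ∑ p ∈ S, f p := fun f =>
    Finset.sum_equiv (reflection κ) hmem fun _ _ => rfl
  have h1 : ∑ p ∈ S, conj (F.point D p) ^ 2 = ∑ p ∈ S, F.point D p ^ 2 := by
    rw [← hsum fun p => F.point D p ^ 2]
    exact Finset.sum_congr rfl fun p _ => by rw [point_reflection hκ, neg_sq]
  have h2 := Finset.sum_congr (rfl : S = S) fun p _ => point_sq_add_conj_sq hD hF hκ p
  rw [Finset.sum_add_distrib, h1, ← Finset.mul_sum, Finset.sum_add_distrib, hsum F.weight] at h2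
  have h3 : thetaThree F N = ∑ p ∈ S, F.weight p := finsum_mem_eq_finite_toFinset_sum _ hfin
  rw [finsum_mem_eq_finite_toFinset_sum _ hfin, h3]
  linear_combination (1 / 2 : ℂ) * h2

end BinForm

/-! ### Hecke forms as combinations of theta series -/

theorem charVal_mul_self {D : ℤ} (φ : QuadClassGroup D →* ℤˣ) (Q : BinForm) :
    charVal φ Q * charVal φ Q = 1 := by
  rw [charVal]
  rcases Int.units_eq_one_or (φ (Q.toClass D)) with h | h <;> simp [h]

theorem charVal_inv {D : ℤ} (φ : QuadClassGroup D →* ℤˣ) (Q : BinForm) :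
    (charVal φ Q)⁻¹ = charVal φ Q :=
  inv_eq_of_mul_eq_one_right (charVal_mul_self φ Q)

/-- The form of weight one of a genus character as a combination of theta series. -/
theorem weightOneForm_eq_sum {D : ℤ} (hD : D < 0) {G : BinForm} (hG : G.disc = D) {ι : Type*}
    [Fintype ι] {R : ι → BinForm} (hR : ∀ i, (R i).IsPrimPosDef D)
    (hrep : ∀ F : BinForm, F.IsPrimPosDef D → ∃! i, F.Equivalent (R i))
    (φ : QuadClassGroup D →* ℤˣ) {N : ℕ} (hN : N ≠ 0) :
    weightOneForm φ N = ∑ i, charVal φ (R i) * thetaOne (R i) N := by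
  rw [weightOneForm, BinForm.card_units_mul_heckeForm hD hG hR hrep (charToHecke φ) hN]
  refine Finset.sum_congr rfl fun i _ => ?_
  have h : ((charToHecke φ).toHom ((R i).toInvIdeal D) : ℂ) = charVal φ (R i) := by
    simp [charToHecke, charVal, BinForm.toClass]
  have hfin := BinForm.finite_eval_eq hD (hR i).disc_eq N
  rw [h, charVal_inv, thetaOne, finsum_mem_eq_finite_toFinset_sum _ hfin,
    finsum_mem_eq_finite_toFinset_sum _ hfin, Finset.mul_sum]
  exact Finset.sum_congr rfl fun p _ => by rw [pow_zero, one_mul, mul_one]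

/-- The form of a Hecke character of `∞`-type two as a combination of theta series, when the form
classes are represented by forms whose leading coefficients divide the middle ones. -/
theorem heckeForm_eq_sum {D : ℤ} (hD : D < 0) {G : BinForm} (hG : G.disc = D) {ι : Type*}
    [Fintype ι] {R : ι → BinForm} (hR : ∀ i, (R i).IsPrimPosDef D)
    (hrep : ∀ F : BinForm, F.IsPrimPosDef D → ∃! i, F.Equivalent (R i))
    {κ : ι → ℤ} (hκ : ∀ i, (R i).b = κ i * (R i).a)
    (φ : QuadClassGroup D →* ℤˣ) (Φ : OrderHeckeChar D 2)
    (hΦ : ∀ i, (Φ.toHom ((R i).toInvIdeal D) : ℂ) = charVal φ (R i) * ((R i).a : ℂ))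
    {N : ℕ} (hN : N ≠ 0) :
    heckeForm Φ N = ∑ i, charVal φ (R i) * thetaThree (R i) N := by
  have h := BinForm.card_units_mul_heckeForm hD hG hR hrep Φ hN
  rw [Φ.card_units_eq_two] at h
  have h2 : ∑ i, ∑ᶠ p ∈ {p : ℤ × ℤ | (R i).eval p.1 p.2 = N},
      (R i).point D p ^ 2 * ((Φ.toHom ((R i).toInvIdeal D) : ℂ))⁻¹ =
      2 * ∑ i, charVal φ (R i) * thetaThree (R i) N := by
    rw [Finset.mul_sum]
    refine Finset.sum_congr rfl fun i _ => ?_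
    have ha : ((R i).a : ℂ) ≠ 0 := by exact_mod_cast (hR i).pos.ne'
    have hfin := BinForm.finite_eval_eq hD (hR i).disc_eq N
    rw [finsum_mem_eq_finite_toFinset_sum _ hfin, ← Finset.sum_mul,
      ← finsum_mem_eq_finite_toFinset_sum _ hfin,
      BinForm.finsum_point_sq hD (hR i).disc_eq (hκ i), hΦ, mul_inv, charVal_inv]
    field_simp
  rw [h2] at h
  exact mul_left_cancel₀ two_ne_zero (by exact_mod_cast h)

/-! ### Absolute convergence and Dirichlet series -/

/-- The Dirichlet series obtained by grouping a sum of `g i / f i ^ k` according to the values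
of `f`. -/
theorem LSeriesHasSum.of_fibers {ι : Type*} {f : ι → ℕ} {g : ι → ℂ} {k : ℕ} (hk : k ≠ 0)
    (hfin : ∀ N ≠ 0, {i | f i = N}.Finite) (h : Summable fun i => g i / (f i : ℂ) ^ k) :
    LSeriesHasSum (fun N => ∑ᶠ i ∈ {i | f i = N}, g i) k (∑' i, g i / (f i : ℂ) ^ k) := by
  have h1 := (Equiv.sigmaFiberEquiv f).hasSum_iff.2 h.hasSum
  refine h1.sigma fun N => ?_
  rcases eq_or_ne N 0 with rfl | hN
  · rw [LSeries.term_zero]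
    refine hasSum_zero.congr_fun fun i => ?_
    simp [i.2, hk]
  · have := (hfin N hN).fintype
    rw [LSeries.term_of_ne_zero hN, Complex.cpow_natCast]
    change HasSum (fun i : {i | f i = N} => g i / (f i : ℂ) ^ k) _
    convert hasSum_fintype (fun i : {i | f i = N} => g i / (f i : ℂ) ^ k) using 1
    rw [← finsum_set_coe_eq_finsum_mem, finsum_eq_sum_of_fintype, Finset.sum_div]
    exact Finset.sum_congr rfl fun i _ => by rw [show f i = N from i.2]

namespace BinForm

variable {D : ℤ} {F : BinForm}

theorem eval_nonneg (hD : D < 0) (hF : F.IsPrimPosDef D) (p : ℤ × ℤ) :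
    0 ≤ F.eval p.1 p.2 := by
  rcases eq_or_ne p 0 with rfl | hp
  · simp [eval]
  · exact (eval_pos hD hF hp).le

/-- Since |α|⁴ = (a·F(p))², this is, up to the factor a², the weight-four Eisenstein series at the
point -ρ/a of the upper half plane. -/
theorem summable_inv_eval_sq (hD : D < 0) (hF : F.IsPrimPosDef D) :
    Summable fun p : ℤ × ℤ => ((F.eval p.1 p.2 : ℝ) ^ 2)⁻¹ := by
  have ha : (0 : ℝ) < F.a := by exact_mod_cast hF.pos
  have haC : (F.a : ℂ) ≠ 0 := by exact_mod_cast hF.pos.ne'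
  let z : UpperHalfPlane := ⟨-F.root D / F.a, by
    rw [← Complex.ofReal_intCast, Complex.div_ofReal_im, Complex.neg_im, root_im]
    have := sqrtNeg_im_pos hD
    refine div_pos ?_ ha
    linarith⟩
  have h := EisensteinSeries.summable_norm_eisSummand (k := 4) (by norm_num) z
  let e : ℤ × ℤ ≃ (Fin 2 → ℤ) :=
    ((Equiv.prodComm ℤ ℤ).trans ((Equiv.neg ℤ).prodCongr (Equiv.refl ℤ))).trans
      (finTwoArrowEquiv ℤ).symm
  have h2 := ((e.summable_iff.2 h).mul_left ((F.a : ℝ) ^ 2)⁻¹)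
  refine h2.congr fun p => ?_
  have h3 : ((e p 0 : ℂ) * z + e p 1) = F.point D p / F.a := by
    change ((-p.2 : ℤ) : ℂ) * (-F.root D / F.a) + p.1 = _
    simp only [point]
    field_simp
    push_cast
    ring
  have h4 : ‖F.point D p‖ ^ 2 = F.a * F.eval p.1 p.2 := by
    rw [← Complex.normSq_eq_norm_sq, normSq_point hD hF.disc_eq]
  simp only [Function.comp_apply, EisensteinSeries.eisSummand, h3]
  rw [norm_zpow, norm_div, zpow_neg, div_zpow]
  have h5 : ‖(F.a : ℂ)‖ = F.a := by
    rw [Complex.norm_intCast, abs_of_pos ha]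
  have h6 : ‖F.point D p‖ ^ (4 : ℤ) = (F.a * F.eval p.1 p.2) ^ 2 := by
    rw [← h4]
    norm_cast
    ring
  rw [h5, h6]
  norm_cast
  push_cast
  rcases eq_or_ne (F.eval p.1 p.2 : ℝ) 0 with h0 | h0
  · simp [h0]
  · field_simp

theorem summable_inv_eval_sq_complex (hD : D < 0) (hF : F.IsPrimPosDef D) :
    Summable fun p : ℤ × ℤ => 1 / (F.eval p.1 p.2 : ℂ) ^ 2 := by
  have h := Complex.ofRealCLM.summable (summable_inv_eval_sq hD hF)
  refine h.congr fun p => ?_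
  simp

/-- The weight grows no faster than F itself, which reduces convergence of ∑ W/F³ to that of ∑ 1/F².
-/
theorem norm_weight_le (hD : D < 0) (hF : F.IsPrimPosDef D) (p : ℤ × ℤ) :
    ‖F.weight p‖ ≤ 4 * F.a * F.c * F.eval p.1 p.2 := by
  have h1 : ((p.1 ^ 2 : ℤ) : ℝ) ≤ ((4 * F.c * F.eval p.1 p.2 : ℤ) : ℝ) :=
    Int.cast_le.2 (sq_fst_le hD hF.disc_eq p.1 p.2)
  have h2 : ((p.2 ^ 2 : ℤ) : ℝ) ≤ ((4 * F.a * F.eval p.1 p.2 : ℤ) : ℝ) :=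
    Int.cast_le.2 (sq_snd_le hD hF.disc_eq p.1 p.2)
  have ha : (0 : ℝ) < F.a := by exact_mod_cast hF.pos
  have hc : (0 : ℝ) < F.c := by exact_mod_cast hF.c_pos hD
  push_cast at h1 h2
  have h3 : F.weight p = ((1 / 2 * (F.a * (p.1 : ℝ) ^ 2 - F.c * (p.2 : ℝ) ^ 2) : ℝ) : ℂ) := by
    simp [weight]
  rw [h3, Complex.norm_real, Real.norm_eq_abs, abs_le]
  have h4 := mul_le_mul_of_nonneg_left h1 ha.le
  have h5 := mul_le_mul_of_nonneg_left h2 hc.le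
  have h6 := mul_nonneg ha.le (sq_nonneg (p.1 : ℝ))
  have h7 := mul_nonneg hc.le (sq_nonneg (p.2 : ℝ))
  constructor <;> linarith

theorem summable_weight_div (hD : D < 0) (hF : F.IsPrimPosDef D) :
    Summable fun p : ℤ × ℤ => F.weight p / (F.eval p.1 p.2 : ℂ) ^ 3 := by
  refine Summable.of_norm_bounded ((summable_inv_eval_sq hD hF).mul_left (4 * F.a * F.c : ℝ))
    fun p => ?_
  have h := norm_weight_le hD hF p
  have hN : (0 : ℝ) ≤ F.eval p.1 p.2 := by exact_mod_cast eval_nonneg hD hF p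
  rw [norm_div, norm_pow, Complex.norm_intCast, abs_of_nonneg hN]
  rcases hN.eq_or_lt with h0 | h0
  · rw [← h0]; simp
  · rw [div_le_iff₀ (pow_pos h0 3)]
    refine h.trans_eq ?_
    field_simp

theorem toNat_eval_eq_iff {N : ℕ} (hD : D < 0) (hF : F.IsPrimPosDef D) (p : ℤ × ℤ) :
    (F.eval p.1 p.2).toNat = N ↔ F.eval p.1 p.2 = N := by
  have := eval_nonneg hD hF p
  omega

theorem lseriesHasSum_theta (hD : D < 0) (hF : F.IsPrimPosDef D) (g : ℤ × ℤ → ℂ) {k : ℕ}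
    (hk : k ≠ 0) (h : Summable fun p : ℤ × ℤ => g p / (F.eval p.1 p.2 : ℂ) ^ k) :
    LSeriesHasSum (fun N : ℕ => ∑ᶠ p ∈ {p : ℤ × ℤ | F.eval p.1 p.2 = N}, g p) k
      (∑' p : ℤ × ℤ, g p / (F.eval p.1 p.2 : ℂ) ^ k) := by
  have hcast : ∀ p : ℤ × ℤ, (((F.eval p.1 p.2).toNat : ℕ) : ℂ) = F.eval p.1 p.2 := fun p => by
    exact_mod_cast congrArg (Int.cast : ℤ → ℂ) (Int.toNat_of_nonneg (eval_nonneg hD hF p))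
  have hset : ∀ N : ℕ, {p : ℤ × ℤ | (F.eval p.1 p.2).toNat = N} =
      {p : ℤ × ℤ | F.eval p.1 p.2 = N} := fun N => Set.ext fun p => toNat_eval_eq_iff hD hF p
  have h1 := LSeriesHasSum.of_fibers (f := fun p : ℤ × ℤ => (F.eval p.1 p.2).toNat) (g := g) hk
    (fun N _ => by rw [hset]; exact finite_eval_eq hD hF.disc_eq N) (by simpa only [hcast] using h)
  simpa only [hcast, hset] using h1

theorem lseriesHasSum_thetaOne (hD : D < 0) (hF : F.IsPrimPosDef D) :
    LSeriesHasSum (thetaOne F) 2 (∑' p : ℤ × ℤ, 1 / (F.eval p.1 p.2 : ℂ) ^ 2) := by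
  exact_mod_cast lseriesHasSum_theta hD hF (fun _ => 1) two_ne_zero
    (summable_inv_eval_sq_complex hD hF)

theorem lseriesHasSum_thetaThree (hD : D < 0) (hF : F.IsPrimPosDef D) :
    LSeriesHasSum (thetaThree F) 3
      (∑' p : ℤ × ℤ, F.weight p / (F.eval p.1 p.2 : ℂ) ^ 3) := by
  exact_mod_cast lseriesHasSum_theta hD hF F.weight three_ne_zero (summable_weight_div hD hF)

/-! ### The Eisenstein-Kronecker series -/

/-- The terms of the Eisenstein-Kronecker series in terms of the quadratic form. -/
theorem kroneckerTerm_eq (hD : D < 0) (hF : F.IsPrimPosDef D) {κ : ℤ} (hκ : F.b = κ * F.a)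
    {d : ℕ} {τ : ℂ} (hτ : d * τ * F.a = -F.root D) (p : ℤ × ℤ) :
    kroneckerTerm d τ (-p.2) p.1 =
      2 * F.a ^ 2 * (F.weight p / (F.eval p.1 p.2 : ℂ) ^ 3 +
        F.weight (reflection κ p) /
          (F.eval (reflection κ p).1 (reflection κ p).2 : ℂ) ^ 3) +
        F.a ^ 2 * (1 / (F.eval p.1 p.2 : ℂ) ^ 2) := by
  have haC : (F.a : ℂ) ≠ 0 := by exact_mod_cast hF.pos.ne'
  have hz : (d * (-p.2 : ℤ) * τ + p.1 : ℂ) = F.point D p / F.a := by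
    rw [eq_div_iff haC, point]
    push_cast
    linear_combination (-p.2 : ℂ) * hτ
  have hz' : (d * (-p.2 : ℤ) * conj τ + p.1 : ℂ) = conj (F.point D p) / F.a := by
    have := congrArg conj hz
    simpa using this
  have hnorm := point_mul_conj hD hF.disc_eq p
  have hsq := point_sq_add_conj_sq hD hF.disc_eq hκ p
  rw [eval_reflection hκ]
  unfold kroneckerTerm
  simp only [hz, hz', Complex.ofReal_mul, Complex.re_eq_add_conj, Complex.ofReal_ofNat]
  rcases eq_or_ne p 0 with rfl | hp
  -- At the origin every quotient is 0 by convention, so the identity holds on all of ℤ².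
  · simp [point, eval]
  set N : ℂ := (F.eval p.1 p.2 : ℂ) with hN
  have hN0 : N ≠ 0 := by
    rw [hN]
    exact_mod_cast (eval_pos hD hF hp).ne'
  set α := F.point D p
  have hα : α ≠ 0 := fun h => by
    rw [h, zero_mul] at hnorm
    exact mul_ne_zero haC hN0 hnorm.symm
  have hα' : conj α ≠ 0 := by simpa using hα
  have hWW : F.weight p / N ^ 3 + F.weight (reflection κ p) / N ^ 3 =
      (α ^ 2 + conj α ^ 2) / (2 * F.a * N ^ 3) := by
    rw [hsq]
    field_simp
  have hNα : N = α * conj α / F.a := by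
    rw [hnorm]
    field_simp
  rw [hWW, hNα]
  simp only [map_mul, map_inv₀, map_pow, map_div₀, Complex.conj_conj, map_intCast]
  generalize conj α = β at *
  field_simp
  ring

/-- The Eisenstein-Kronecker series in terms of the quadratic form. -/
theorem hasSum_kroneckerTerm (hD : D < 0) (hF : F.IsPrimPosDef D) {κ : ℤ} (hκ : F.b = κ * F.a)
    {d : ℕ} {τ : ℂ} (hτ : d * τ * F.a = -F.root D) :
    HasSum (fun p : {p : ℤ × ℤ // p ≠ 0} => kroneckerTerm d τ p.1.1 p.1.2)
      (4 * F.a ^ 2 * ∑' p : ℤ × ℤ, F.weight p / (F.eval p.1 p.2 : ℂ) ^ 3 +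
        F.a ^ 2 * ∑' p : ℤ × ℤ, 1 / (F.eval p.1 p.2 : ℂ) ^ 2) := by
  have hW := (summable_weight_div hD hF).hasSum
  have h1 := (summable_inv_eval_sq_complex hD hF).hasSum
  have h2 := ((hW.add ((reflection κ).hasSum_iff.2 hW)).mul_left (2 * (F.a : ℂ) ^ 2)).add
    (h1.mul_left ((F.a : ℂ) ^ 2))
  have h3 : HasSum (fun p : ℤ × ℤ => kroneckerTerm d τ (-p.2) p.1) _ :=
    h2.congr_fun fun p => kroneckerTerm_eq hD hF hκ hτ p
  -- This undoes the substitution (m, n) = (-y, x).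
  let e : ℤ × ℤ ≃ ℤ × ℤ := (Equiv.prodComm ℤ ℤ).trans ((Equiv.refl ℤ).prodCongr (Equiv.neg ℤ))
  have h4 := e.hasSum_iff.2 h3
  have h5 : HasSum (fun p : ℤ × ℤ => kroneckerTerm d τ p.1 p.2) _ :=
    h4.congr_fun fun p => by
      change kroneckerTerm d τ p.1 p.2 = kroneckerTerm d τ (- -p.1) p.2
      rw [neg_neg]
  have h6 := (hasSum_subtype_iff_of_support_subset (s := {p : ℤ × ℤ | p ≠ 0}) fun p hp => by
    rintro rfl
    exact hp (by simp [kroneckerTerm])).2 h5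
  refine Eq.subst (motive := HasSum fun p : {p : ℤ × ℤ // p ≠ 0} =>
    kroneckerTerm d τ p.1.1 p.1.2) ?_ h6
  ring

end BinForm

end

/-! ### Assembly over the representatives -/

theorem corollary4p4 (D : ℤ) (hD : D < 0) (g : ℕ)
    (hCl : Nonempty (QuadClassGroup D ≃* Multiplicative (Fin g → ZMod 2)))
    (a : ℕ) (ha : 0 < a) (k c : ℤ) (Q : BinForm) (hQ : Q = ⟨(a : ℤ), k * (a : ℤ), c⟩)
    (hdisc : Q.disc = D)
    (δ : Finset ℕ) (hδ : δ ⊆ a.divisors)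
    (hform : ∀ d ∈ δ, (Q.divBy d).IsPrimPosDef D)
    (hrep : ∀ F : BinForm, F.IsPrimPosDef D → ∃! d : ℕ, d ∈ δ ∧ F.Equivalent (Q.divBy d))
    (φ : QuadClassGroup D →* ℤˣ) :
    -- all series involved converge absolutely
    (∀ d ∈ δ, Summable fun p : {p : ℤ × ℤ // p ≠ 0} => kroneckerTerm d Q.tau p.1.1 p.1.2) ∧
    LSeriesSummable (weightThreeForm φ Q δ) 3 ∧ LSeriesSummable (weightOneForm φ) 2 ∧
    -- the identity
    ∑ d ∈ δ, charVal φ (Q.divBy d) * ((Q.tau.im : ℂ) / (2 * (Real.pi : ℂ)) ^ 3) *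
          (d : ℂ) ^ 2 * kroneckerH d Q.tau =
      (a : ℂ) * (Real.sqrt (-(D : ℝ)) : ℂ) / (2 * (Real.pi : ℂ)) ^ 3 *
        (2 * LSeries (weightThreeForm φ Q δ) 3 + 1 / 2 * LSeries (weightOneForm φ) 2) ∧
    -- the form of weight one is the combination of the theta series
    (∀ n : ℕ, n ≠ 0 →
      weightOneForm φ n = ∑ d ∈ δ, charVal φ (Q.divBy d) * thetaOne (Q.divBy d) n) ∧
    -- the form of weight three is the form of the Hecke character given by `φ`
    (∀ Φ : OrderHeckeChar D 2,
      (∀ d ∈ δ, (Φ.toHom ((Q.divBy d).toInvIdeal D) : ℂ) =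
        charVal φ (Q.divBy d) * ((Q.divBy d).a : ℂ)) →
      (∀ n : ℕ, n ≠ 0 → heckeForm Φ n = weightThreeForm φ Q δ n) ∧
      ∑ d ∈ δ, charVal φ (Q.divBy d) * ((Q.tau.im : ℂ) / (2 * (Real.pi : ℂ)) ^ 3) *
            (d : ℂ) ^ 2 * kroneckerH d Q.tau =
        (a : ℂ) * (Real.sqrt (-(D : ℝ)) : ℂ) / (2 * (Real.pi : ℂ)) ^ 3 *
          (2 * LSeries (heckeForm Φ) 3 + 1 / 2 * LSeries (weightOneForm φ) 2)) := by
  have hR : ∀ i : δ, (Q.divBy i).IsPrimPosDef D := fun i => hform i i.2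
  have hrep' : ∀ F : BinForm, F.IsPrimPosDef D → ∃! i : δ, F.Equivalent (Q.divBy i) := by
    intro F hF
    obtain ⟨d, ⟨hd, hFd⟩, huniq⟩ := hrep F hF
    exact ⟨⟨d, hd⟩, hFd, fun i hi => Subtype.ext (huniq i ⟨i.2, hi⟩)⟩
  have hda : ∀ d ∈ δ, (Q.divBy d).a * d = a := fun d hd => by
    have hdvd : (d : ℤ) ∣ a := by exact_mod_cast Nat.dvd_of_mem_divisors (hδ hd)
    rw [hQ]
    exact Int.ediv_mul_cancel hdvd
  -- Leading coefficients of the Q_{/d} still divide the middle one, with quotient κ = kd; this is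
  -- what provides the reflection for each representative.
  have hb : ∀ d ∈ δ, (Q.divBy d).b = (k * d) * (Q.divBy d).a := fun d hd => by
    rw [mul_assoc, mul_comm (d : ℤ), hda d hd, hQ]
    rfl
  have haC : (a : ℂ) ≠ 0 := by exact_mod_cast ha.ne'
  have htau : Q.tau = (-(k * a : ℂ) + sqrtNeg D) / (2 * a) := by
    rw [BinForm.tau, hdisc, hQ]
    push_cast
    rfl
  have hτ : ∀ d ∈ δ, d * Q.tau * (Q.divBy d).a = -(Q.divBy d).root D := fun d hd => by
    have h1 : ((Q.divBy d).a : ℂ) * d = a := by exact_mod_cast hda d hd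
    have h2 : (Q.divBy d).b = k * a := by rw [hQ]; rfl
    have h3 : Q.tau * a = (-(k * a : ℂ) + sqrtNeg D) / 2 := by
      rw [htau]
      field_simp
    rw [BinForm.root, h2]
    push_cast
    linear_combination Q.tau * h1 + h3
  have him : (Q.tau.im : ℂ) = (Real.sqrt (-(D : ℝ)) : ℂ) / (2 * a) := by
    have h1 : Q.tau = ((-(k : ℝ) / 2 : ℝ) : ℂ) +
        ((Real.sqrt (-(D : ℝ)) / (2 * a) : ℝ) : ℂ) * Complex.I := by
      rw [htau, sqrtNeg]
      push_cast
      field_simp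
    rw [h1, Complex.add_im, Complex.ofReal_im, Complex.im_ofReal_mul, Complex.I_im]
    push_cast
    ring
  have hK := fun d (hd : d ∈ δ) =>
    BinForm.hasSum_kroneckerTerm hD (hform d hd) (hb d hd) (hτ d hd)
  have hL3 : LSeriesHasSum (weightThreeForm φ Q δ) 3 (∑ d ∈ δ, charVal φ (Q.divBy d) *
      ∑' p : ℤ × ℤ, (Q.divBy d).weight p / ((Q.divBy d).eval p.1 p.2 : ℂ) ^ 3) := by
    have h := LSeriesHasSum.sum (S := δ) fun d hd =>
      (BinForm.lseriesHasSum_thetaThree hD (hform d hd)).smul (charVal φ (Q.divBy d))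
    refine (LSeriesHasSum_congr 3 _ fun {n} _ => ?_).1 h
    simp [weightThreeForm]
  have hone : ∀ n : ℕ, n ≠ 0 →
      weightOneForm φ n = ∑ d ∈ δ, charVal φ (Q.divBy d) * thetaOne (Q.divBy d) n :=
    fun n hn => by
      rw [weightOneForm_eq_sum hD hdisc hR hrep' φ hn]
      exact Finset.sum_coe_sort δ fun d => charVal φ (Q.divBy d) * thetaOne (Q.divBy d) n
  have hL1 : LSeriesHasSum (weightOneForm φ) 2 (∑ d ∈ δ, charVal φ (Q.divBy d) *
      ∑' p : ℤ × ℤ, 1 / ((Q.divBy d).eval p.1 p.2 : ℂ) ^ 2) := by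
    have h := LSeriesHasSum.sum (S := δ) fun d hd =>
      (BinForm.lseriesHasSum_thetaOne hD (hform d hd)).smul (charVal φ (Q.divBy d))
    refine (LSeriesHasSum_congr 2 _ fun {n} hn => ?_).1 h
    simp [hone n hn]
  have hid : ∑ d ∈ δ, charVal φ (Q.divBy d) * ((Q.tau.im : ℂ) / (2 * (Real.pi : ℂ)) ^ 3) *
          (d : ℂ) ^ 2 * kroneckerH d Q.tau =
      (a : ℂ) * (Real.sqrt (-(D : ℝ)) : ℂ) / (2 * (Real.pi : ℂ)) ^ 3 *
        (2 * LSeries (weightThreeForm φ Q δ) 3 + 1 / 2 * LSeries (weightOneForm φ) 2) := by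
    rw [hL3.LSeries_eq, hL1.LSeries_eq, Finset.mul_sum, Finset.mul_sum, ← Finset.sum_add_distrib,
      Finset.mul_sum]
    refine Finset.sum_congr rfl fun d hd => ?_
    -- With A = a/d, the factor d² turns the A² in H_d into a², so each d contributes with the same
    -- constant.
    have h1 : (a : ℂ) = (Q.divBy d).a * d := by exact_mod_cast (hda d hd).symm
    have hd0 : (d : ℂ) ≠ 0 := right_ne_zero_of_mul (h1 ▸ haC)
    have hA0 : ((Q.divBy d).a : ℂ) ≠ 0 := left_ne_zero_of_mul (h1 ▸ haC)
    have hπ : (Real.pi : ℂ) ≠ 0 := by exact_mod_cast Real.pi_ne_zero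
    rw [kroneckerH, (hK d hd).tsum_eq, him, h1]
    field_simp
    ring
  refine ⟨fun d hd => (hK d hd).summable, hL3.LSeriesSummable, hL1.LSeriesSummable, hid, hone,
    fun Φ hΦ => ?_⟩
  have hthree : ∀ n : ℕ, n ≠ 0 → heckeForm Φ n = weightThreeForm φ Q δ n := fun n hn => by
    rw [heckeForm_eq_sum hD hdisc hR hrep' (fun i => hb i i.2) φ Φ (fun i => hΦ i i.2) hn]
    exact Finset.sum_coe_sort δ fun d => charVal φ (Q.divBy d) * thetaThree (Q.divBy d) n
  exact ⟨hthree, by rw [LSeries_congr (fun {n} hn => hthree n hn) 3, hid]⟩
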